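/- **Setting.** Let $L>0$ and $k\ge 1$. The looping-edge graph $\mathcal G$ consists of the edge $e_0=[-L,L]$ and $2k$ half-lines $[L,\infty)$, indexed by two sets $E_+$, $E_-$ with $|E_+|=|E_-|=k$; the end point $-L$ of $e_0$ is treated as a terminal vertex. Let $\alpha_e,\beta_e$ ($e\in\{e_0\}\cup E_+\cup E_-$) be real numbers with $\alpha_0:=\alpha_{e_0}\neq 0$, $\alpha_e>0$ for $e\in E_+$ and $\alpha_e<0$ for $e\in E_-$; write $\beta_0:=\beta_{e_0}$. Put $L^2(\mathcal G)=L^2(-L,L)\oplus\bigoplus_{e\in E_+\cup E_-}L^2(L,\infty)$ and $H^3(\mathcal G)=H^3(-L,L)\oplus\bigoplus_{e\in E_+\cup E_-}H^3(L,\infty)$ (complex-valued functions). Let $A_0$ be the operator in $L^2(\mathcal G)$ with domain $C_0^\infty(-L,L)\oplus\bigoplus_{e} C_0^\infty(L,\infty)$ and $$A_0(u_e)_e=(\alpha_e\partial_x^3u_e+\beta_e\partial_xu_e)_e ,$$ and let $A_0^*$ be its Hilbert space adjoint. Its domain is $D(A_0^*)=H^3(\mathcal G)$; this is part of the claim. For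 a function $u$ in $H^3$ of an interval and an end point $a$, let $\partial u(a)=(u(a),u'(a),u''(a))\in\mathbb C^3$. For $U=(\phi,(\psi_e)_e)\in H^3(\mathcal G)$ put $$T_+U=\big(\partial\phi(-L),(\partial\psi_e(L))_{e\in E_+}\big),\qquad T_-U=\big(\partial\phi(L),(\partial\psi_e(L))_{e\in E_-}\big),$$ and let $\mathcal B_\pm=\{T_\pm U: U\in H^3(\mathcal G)\}\subset\mathbb C^{3(k+1)}$. Let $$B_e=\begin{pmatrix}\beta_e&0&\alpha_e\\0&-\alpha_e&0\\ \alpha_e&0&0\end{pmatrix},\qquad B_0:=B_{e_0},\qquad B_+=\mathrm{diag}\big(B_0,(B_e)_{e\in E_+}\big),\qquad B_-=\mathrm{diag}\big(B_0,(-B_e)_{e\in E_-}\big),$$ and define on $\mathcal B_+\oplus\mathcal B_-$ the sesquilinear form $$w\big((x,y),(\tilde x,\tilde y)\big)=(B_+x\mid\tilde x)-(B_-y\mid\tilde y),$$ where $(\cdot\mid\cdot)$ is the standard inner product of $\mathbb C^{3(k+1)}$. A linear subspace $X\subset\mathcal B_+\oplus\mathcal B_-$ is called $w$-self-orthogonal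 if $$X=\{p\in\mathcal B_+\oplus\mathcal B_-:\ w(p,q)=0\ \text{for all } q\in X\}.$$ Let $F$ be the boundary-trace map on the graph of the maximal Airy operator $-A_0^*$, $$F:\ G(-A_0^*)\to\mathcal B_+\oplus\mathcal B_-,\qquad F(U,-A_0^*U)=(T_+U,T_-U).$$ **Proposition.** $D(A_0^*)=H^3(\mathcal G)$. Moreover, a linear operator $A$ in $L^2(\mathcal G)$ which extends $A_0$ is skew-self-adjoint (that is, densely defined with $A^*=-A$ and $D(A^*)=D(A)$) if and only if there is a $w$-self-orthogonal subspace $X\subset\mathcal B_+\oplus\mathcal B_-$ such that its graph is $G(A)=F^{-1}(X)$. -/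

import Mathlib

open MeasureTheory Set TopologicalSpace
open scoped Distributions ENNReal Matrix

noncomputable section

namespace LoopingEdge

/-! ### `L²`, Sobolev spaces and boundary values on an open subset of the line -/

/-- The complex Hilbert space `L²(Ω)`, for Lebesgue measure on the open set `Ω ⊆ ℝ`. -/
abbrev L2 (Ω : Opens ℝ) : Type := Lp ℂ 2 (volume.restrict (Ω : Set ℝ))

/-- `v ∈ L²(Ω)` is the weak derivative of order `n` of `u ∈ L²(Ω)`. -/
def IsWeakDeriv {Ω : Opens ℝ} (n : ℕ) (u v : L2 Ω) : Prop :=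
  ∀ φ : 𝓓(Ω, ℂ), ∫ x in (Ω : Set ℝ), u x * iteratedDeriv n φ x =
    (-1) ^ n * ∫ x in (Ω : Set ℝ), v x * φ x

/-- The Sobolev space `Hⁿ(Ω)`: functions in `L²(Ω)` whose weak derivatives of all orders `≤ n`
exist and are in `L²(Ω)`. -/
def sobolevSpace (n : ℕ) (Ω : Opens ℝ) : Set (L2 Ω) :=
  {u | ∀ j ≤ n, ∃ v : L2 Ω, IsWeakDeriv j u v}

open Classical in
/-- The vector `∂u(a) = (u(a), u'(a), u''(a))` of boundary values at a point `a` of the closure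
of `Ω`: the value and the first two derivatives at `a` of a `C²` representative of `u`
(every `u ∈ H³` of an interval has one). By `jet_eq` it does not depend on the representative.
The value is `0` if `u` has no `C²` representative. -/
def jet {Ω : Opens ℝ} (u : L2 Ω) (a : ℝ) : Fin 3 → ℂ :=
  if h : ∃ g : ℝ → ℂ, ContDiff ℝ 2 g ∧ u =ᵐ[volume.restrict (Ω : Set ℝ)] g then
    fun j => iteratedDeriv j h.choose a
  else 0

theorem jet_eq {Ω : Opens ℝ} {u : L2 Ω} {g : ℝ → ℂ} (hg : ContDiff ℝ 2 g)
    (hu : u =ᵐ[volume.restrict (Ω : Set ℝ)] g) {a : ℝ} (ha : a ∈ closure (Ω : Set ℝ)) :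
    jet u a = fun j : Fin 3 => iteratedDeriv j g a := by
  have h : ∃ g : ℝ → ℂ, ContDiff ℝ 2 g ∧ u =ᵐ[volume.restrict (Ω : Set ℝ)] g := ⟨g, hg, hu⟩
  have key : EqOn h.choose g (Ω : Set ℝ) :=
    Measure.eqOn_open_of_ae_eq (h.choose_spec.2.symm.trans hu) Ω.isOpen
      h.choose_spec.1.continuous.continuousOn hg.continuous.continuousOn
  funext j
  rw [jet, dif_pos h]
  have hj : ((j : ℕ) : WithTop ℕ∞) ≤ 2 := by
    have : (j : ℕ) ≤ 2 := by omega
    exact_mod_cast this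
  exact (key.iteratedDeriv_of_isOpen Ω.isOpen j).closure
    (h.choose_spec.1.continuous_iteratedDeriv _ hj) (hg.continuous_iteratedDeriv _ hj) ha

/-! ### The graph, its function spaces and the Airy operator -/

/-- The edges of the graph: the loop edge `none`, and the half-lines, split into
`E₊ = {some (inl i)}` and `E₋ = {some (inr i)}`, with `i : Fin k`. -/
abbrev Edge (k : ℕ) : Type := Option (Fin k ⊕ Fin k)

/-- The (open) interval that parametrizes an edge: `(-L, L)` for the loop edge and `(L, ∞)` for
each half-line. -/
def edgeSet {k : ℕ} (L : ℝ) : Edge k → Opens ℝ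
  | none => ⟨Ioo (-L) L, isOpen_Ioo⟩
  | some _ => ⟨Ioi L, isOpen_Ioi⟩

/-- The Hilbert space `L²(𝒢) = L²(-L, L) ⊕ ⨁ L²(L, ∞)`. -/
abbrev L2G (k : ℕ) (L : ℝ) : Type := PiLp 2 fun e : Edge k => L2 (edgeSet L e)

/-- The Sobolev space `Hⁿ(𝒢) = Hⁿ(-L, L) ⊕ ⨁ Hⁿ(L, ∞)`. -/
def sobolevSpaceG (n k : ℕ) (L : ℝ) : Set (L2G k L) :=
  {U | ∀ e, U e ∈ sobolevSpace n (edgeSet L e)}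

/-- The graph of the Airy operator on test functions: the pairs `(U, V)` in which `U e` is (the
class of) a function `φ e` in `C₀^∞` of the open edge `e` and `V e = α_e φ_e''' + β_e φ_e'`. -/
def airyGraph {k : ℕ} (L : ℝ) (α β : Edge k → ℝ) : Submodule ℂ (L2G k L × L2G k L) where
  carrier := {p | ∃ φ : (e : Edge k) → 𝓓(edgeSet L e, ℂ), ∀ e,
    p.1 e =ᵐ[volume.restrict (edgeSet L e : Set ℝ)] φ e ∧
    p.2 e =ᵐ[volume.restrict (edgeSet L e : Set ℝ)]
      fun x => (α e : ℂ) * iteratedDeriv 3 (φ e) x + (β e : ℂ) * deriv (φ e) x}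
  zero_mem' := by
    refine ⟨fun _ => 0, fun e => ⟨?_, ?_⟩⟩
    · filter_upwards [Lp.coeFn_zero ℂ 2 (volume.restrict (edgeSet L e : Set ℝ))] with x hx
      simpa using hx
    · filter_upwards [Lp.coeFn_zero ℂ 2 (volume.restrict (edgeSet L e : Set ℝ))] with x hx
      have h0 : ((0 : 𝓓(edgeSet L e, ℂ)) : ℝ → ℂ) = fun _ => 0 := rfl
      simp only [h0, iteratedDeriv_const]
      simpa using hx
  add_mem' := by
    rintro p q ⟨φ, hφ⟩ ⟨ψ, hψ⟩
    refine ⟨fun e => φ e + ψ e, fun e => ⟨?_, ?_⟩⟩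
    · filter_upwards [Lp.coeFn_add (p.1 e) (q.1 e), (hφ e).1, (hψ e).1] with x hx h1 h2
      simpa [h1, h2] using hx
    · filter_upwards [Lp.coeFn_add (p.2 e) (q.2 e), (hφ e).2, (hψ e).2] with x hx h1 h2
      have c1 : ContDiff ℝ 3 (φ e) := (φ e).contDiff.of_le (WithTop.coe_le_coe.2 (le_top : (3 : ℕ∞) ≤ ⊤))
      have c2 : ContDiff ℝ 3 (ψ e) := (ψ e).contDiff.of_le (WithTop.coe_le_coe.2 (le_top : (3 : ℕ∞) ≤ ⊤))
      have hs : ((φ e + ψ e : 𝓓(edgeSet L e, ℂ)) : ℝ → ℂ) = (φ e : ℝ → ℂ) + ψ e := rfl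
      have hx' : (p + q).2 e x = p.2 e x + q.2 e x := hx
      rw [hx', h1, h2, hs, iteratedDeriv_add c1.contDiffAt c2.contDiffAt,
        deriv_add (c1.differentiable (by norm_num) x) (c2.differentiable (by norm_num) x)]
      ring
  smul_mem' := by
    rintro c p ⟨φ, hφ⟩
    refine ⟨fun e => c • φ e, fun e => ⟨?_, ?_⟩⟩
    · filter_upwards [Lp.coeFn_smul c (p.1 e), (hφ e).1] with x hx h1
      simpa [h1] using hx
    · filter_upwards [Lp.coeFn_smul c (p.2 e), (hφ e).2] with x hx h1
      have c1 : ContDiff ℝ 3 (φ e) := (φ e).contDiff.of_le (WithTop.coe_le_coe.2 (le_top : (3 : ℕ∞) ≤ ⊤))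
      have hs : ((c • φ e : 𝓓(edgeSet L e, ℂ)) : ℝ → ℂ) = c • (φ e : ℝ → ℂ) := rfl
      have hx' : (c • p).2 e x = c * p.2 e x := hx
      rw [hx', h1, hs, iteratedDeriv_const_smul c1.contDiffAt,
        deriv_const_smul c (c1.differentiable (by norm_num) x)]
      simp only [smul_eq_mul]
      ring

/-- The Airy operator `A₀ U = (α_e ∂³U_e + β_e ∂U_e)_e` in `L²(𝒢)`, with domain
`C₀^∞(-L, L) ⊕ ⨁ C₀^∞(L, ∞)`. -/
def airy {k : ℕ} (L : ℝ) (α β : Edge k → ℝ) : L2G k L →ₗ.[ℂ] L2G k L :=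
  (airyGraph L α β).toLinearPMap

/-- `A₀` is well defined: `airyGraph` is single-valued and it is the graph of `airy`. -/
theorem airy_graph {k : ℕ} (L : ℝ) (α β : Edge k → ℝ) :
    (airy L α β).graph = airyGraph L α β := by
  refine Submodule.toLinearPMap_graph_eq _ ?_
  rintro ⟨U, V⟩ ⟨φ, hφ⟩ hU
  dsimp only at hU hφ ⊢
  subst hU
  ext1 e
  have hz : (φ e : ℝ → ℂ) = fun _ => 0 := by
    have h0 : EqOn (φ e) (fun _ => (0 : ℂ)) (edgeSet L e : Set ℝ) := by
      refine Measure.eqOn_open_of_ae_eq (μ := volume) ?_ (edgeSet L e).isOpen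
        (φ e).continuous.continuousOn continuousOn_const
      exact (hφ e).1.symm.trans (Lp.coeFn_zero ℂ 2 _)
    funext x
    by_cases hx : x ∈ (edgeSet L e : Set ℝ)
    · exact h0 hx
    · exact image_eq_zero_of_notMem_tsupport fun h => hx ((φ e).tsupport_subset h)
  refine Lp.ext ?_
  filter_upwards [(hφ e).2, Lp.coeFn_zero ℂ 2 (volume.restrict (edgeSet L e : Set ℝ))]
    with x h1 h2
  rw [h1, hz]
  have h2' : ((0 : L2G k L) e : ℝ → ℂ) x = 0 := h2
  rw [iteratedDeriv_const, deriv_const, if_neg (by norm_num)]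
  exact (by simp : (α e : ℂ) * 0 + (β e : ℂ) * 0 = 0).trans h2'.symm

/-- `A` is skew-self-adjoint: densely defined with `A* = -A` (in particular `D(A*) = D(A)`). -/
def IsSkewSelfAdjoint {H : Type*} [NormedAddCommGroup H] [InnerProductSpace ℂ H]
    [CompleteSpace H] (A : H →ₗ.[ℂ] H) : Prop :=
  Dense (A.domain : Set H) ∧ A.adjoint = -A

/-! ### Boundary spaces, the boundary form and the trace map -/

/-- `ℂ^{3(k+1)}`, as stacks of `k + 1` vectors of `ℂ³`; block `none` belongs to an end point of
the loop edge and block `some i` to a half-line. -/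
abbrev BVec (k : ℕ) : Type := Fin 3 × Option (Fin k) → ℂ

/-- The stacked vector `(∂φ(-L), ∂ψ₊(L))`, with `ψ₊` the components on the half-lines in `E₊`. -/
def tracePlus {k : ℕ} {L : ℝ} (U : L2G k L) : BVec k
  | (j, none) => jet (U none) (-L) j
  | (j, some i) => jet (U (some (Sum.inl i))) L j

/-- The stacked vector `(∂φ(L), ∂ψ₋(L))`, with `ψ₋` the components on the half-lines in `E₋`. -/
def traceMinus {k : ℕ} {L : ℝ} (U : L2G k L) : BVec k
  | (j, none) => jet (U none) L j
  | (j, some i) => jet (U (some (Sum.inr i))) L j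

/-- The boundary space `𝓑₊ = {(∂φ(-L), ∂ψ₊(L)) : (φ, ψ) ∈ H³(𝒢)}`. -/
def boundaryPlus (k : ℕ) (L : ℝ) : Set (BVec k) := tracePlus '' sobolevSpaceG 3 k L

/-- The boundary space `𝓑₋ = {(∂φ(L), ∂ψ₋(L)) : (φ, ψ) ∈ H³(𝒢)}`. -/
def boundaryMinus (k : ℕ) (L : ℝ) : Set (BVec k) := traceMinus '' sobolevSpaceG 3 k L

/-- The matrix `B_e` of the edge with coefficients `a = α_e`, `b = β_e`. -/
def edgeMatrix (a b : ℝ) : Matrix (Fin 3) (Fin 3) ℂ :=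
  !![(b : ℂ), 0, a; 0, -a, 0; a, 0, 0]

/-- `B₊ = diag(B₀, (B_e)_{e ∈ E₊})`. -/
def matPlus {k : ℕ} (α β : Edge k → ℝ) :
    Matrix (Fin 3 × Option (Fin k)) (Fin 3 × Option (Fin k)) ℂ :=
  Matrix.blockDiagonal fun
    | none => edgeMatrix (α none) (β none)
    | some i => edgeMatrix (α (some (Sum.inl i))) (β (some (Sum.inl i)))

/-- `B₋ = diag(B₀, (-B_e)_{e ∈ E₋})`. -/
def matMinus {k : ℕ} (α β : Edge k → ℝ) :
    Matrix (Fin 3 × Option (Fin k)) (Fin 3 × Option (Fin k)) ℂ :=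
  Matrix.blockDiagonal fun
    | none => edgeMatrix (α none) (β none)
    | some i => -edgeMatrix (α (some (Sum.inr i))) (β (some (Sum.inr i)))

/-- The sesquilinear form `w((x, y), (x', y')) = (B₊ x | x') - (B₋ y | y')`, where `(· | ·)` is
the standard inner product of `ℂ^{3(k+1)}`, linear in the first argument. -/
def bform {k : ℕ} (α β : Edge k → ℝ) (p q : BVec k × BVec k) : ℂ :=
  (matPlus α β *ᵥ p.1) ⬝ᵥ star q.1 - (matMinus α β *ᵥ p.2) ⬝ᵥ star q.2

/-- The subspace `X` of `𝓑₊ ⊕ 𝓑₋` is `w`-self-orthogonal: `X` is equal to its `w`-orthogonal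
complement in `𝓑₊ ⊕ 𝓑₋`. -/
def IsSelfOrthogonal {k : ℕ} (L : ℝ) (α β : Edge k → ℝ)
    (X : Submodule ℂ (BVec k × BVec k)) : Prop :=
  (X : Set (BVec k × BVec k)) =
    {p ∈ boundaryPlus k L ×ˢ boundaryMinus k L | ∀ q ∈ X, bform α β p q = 0}

/-- The boundary-trace map `F`, on the graph of the maximal Airy operator `-A₀*` (the operator
with the same differential expression as `A₀`): it sends `(U, -A₀* U)` to
`((∂φ(-L), ∂ψ₊(L)), (∂φ(L), ∂ψ₋(L)))`. -/
def traceMap {k : ℕ} (L : ℝ) (α β : Edge k → ℝ) :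
    (-(airy L α β).adjoint).graph → BVec k × BVec k :=
  fun p => (tracePlus p.1.1, traceMinus p.1.1)

end LoopingEdge

end

open LoopingEdge

/-!
The maximal operator `M = -A₀*` acts by the same differential expression as `A₀`, on `H³(𝒢)`, and
its failure to be skew-symmetric is carried by the boundary values: by Green's formula
`⟪V, M U⟫ + ⟪M V, U⟫ = -w(F U, F V)` (`inner_add_inner_eq`). Every extension `A` of `A₀` satisfies
`-A* ⊆ M`, so when `A ⊆ M` the operator `-A*` is the restriction of `M` to those `U` whose traces
are `w`-orthogonal to the traces of `D(A)` (`mem_graph_neg_adjoint_iff_bform`). The trace map from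
`H³(𝒢)` is onto `ℂ^{3(k+1)} ⊕ ℂ^{3(k+1)}` (`exists_trace_eq`), by cutting off quadratic
polynomials. Hence `A = -A*` says exactly that the space of traces of `A` is its own `w`-orthogonal
complement and that `A` consists of all elements of `M` with traces in that space.

The identification `D(A₀*) = H³(𝒢)` (`mem_graph_maximal_iff`, `adjoint_domain_eq`) is a regularity
statement: if `u, f ∈ L²` of an edge and `α u''' + β u' = f` weakly, then `u ∈ H³`. A distribution
on an interval with zero derivative is constant, so integrating the equation three times exhibits
`u` as a `C²` function with absolutely continuous second derivative
(`exists_primitives_of_weak_airy`). On the bounded edge this is enough. On a half-line the square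
integrability of `u'` and `u''` needs the interpolation estimate `memLp_of_airy_Ioi`: the function
`v = α u'' + β u` has derivative `f`, and its weighted mean over `[x, x + 1]` is, after moving the
derivatives to the weight, bounded by the integral of `|u|` there; so `|v x|` is bounded by an
integral over `[x, x + 1]` of a square integrable function, and such averages are square integrable.
The same argument then bounds `u'` in terms of `u` and `u''`.

Elements of `H³` are handled through families `g 0, g 1, g 2, g 3` of functions on `ℝ`, each an
indefinite integral of the next (`IsPrimitive`, `IsSobolevRep`).
-/

open Filter Topology

namespace LoopingEdge

/-! ### Absolutely continuous functions -/

/-- `p` is a locally absolutely continuous function on `ℝ` with derivative `q` in the sense of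
Lebesgue: `q` is locally integrable and `p` is an indefinite integral of `q`. -/
structure IsPrimitive (p q : ℝ → ℂ) : Prop where
  locallyIntegrable : LocallyIntegrable q volume
  sub_eq : ∀ x y, p y - p x = ∫ t in x..y, q t

theorem intervalIntegrable_of_locallyIntegrable {E : Type*} [NormedAddCommGroup E] {q : ℝ → E}
    (hq : LocallyIntegrable q volume) (x y : ℝ) : IntervalIntegrable q volume x y :=
  intervalIntegrable_iff.mpr
    ((hq.integrableOn_isCompact isCompact_uIcc).mono_set uIoc_subset_uIcc)

namespace IsPrimitive

variable {p q p₁ q₁ p₂ q₂ : ℝ → ℂ}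

theorem intervalIntegrable (h : IsPrimitive p q) (x y : ℝ) : IntervalIntegrable q volume x y :=
  intervalIntegrable_of_locallyIntegrable h.locallyIntegrable x y

theorem eq_add (h : IsPrimitive p q) (x y : ℝ) : p y = p x + ∫ t in x..y, q t := by
  rw [← h.sub_eq x y]; ring

theorem continuous (h : IsPrimitive p q) : Continuous p := by
  have : p = fun y => p 0 + ∫ t in (0 : ℝ)..y, q t := funext fun y => h.eq_add 0 y
  rw [this]
  exact continuous_const.add
    (intervalIntegral.continuous_primitive (fun a b => h.intervalIntegrable a b) 0)

theorem of_integral (hq : LocallyIntegrable q volume) (c : ℂ) (a : ℝ) :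
    IsPrimitive (fun x => c + ∫ t in a..x, q t) q := by
  refine ⟨hq, fun x y => ?_⟩
  have := intervalIntegral.integral_interval_sub_left
    (intervalIntegrable_of_locallyIntegrable hq a y)
    (intervalIntegrable_of_locallyIntegrable hq a x)
  rw [← this]; ring

theorem of_hasDerivAt (h : ∀ x, HasDerivAt p (q x) x) (hq : Continuous q) : IsPrimitive p q :=
  ⟨hq.locallyIntegrable, fun x y =>
    (intervalIntegral.integral_eq_sub_of_hasDerivAt (fun t _ => h t)
      (hq.intervalIntegrable x y)).symm⟩

theorem hasDerivAt (h : IsPrimitive p q) (hq : Continuous q) (x : ℝ) : HasDerivAt p (q x) x := by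
  have : p = fun y => p 0 + ∫ t in (0 : ℝ)..y, q t := funext fun y => h.eq_add 0 y
  rw [this]
  exact (hq.integral_hasStrictDerivAt 0 x).hasDerivAt.const_add _

theorem ae_hasDerivAt (h : IsPrimitive p q) : ∀ᵐ x, HasDerivAt p (q x) x := by
  have : p = fun y => p 0 + ∫ t in (0 : ℝ)..y, q t := funext fun y => h.eq_add 0 y
  filter_upwards [LocallyIntegrable.ae_hasDerivAt_integral h.locallyIntegrable] with x hx
  rw [this]
  exact (hx 0).const_add _

theorem add (h₁ : IsPrimitive p₁ q₁) (h₂ : IsPrimitive p₂ q₂) :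
    IsPrimitive (fun x => p₁ x + p₂ x) fun x => q₁ x + q₂ x := by
  refine ⟨h₁.locallyIntegrable.add h₂.locallyIntegrable, fun x y => ?_⟩
  rw [intervalIntegral.integral_add (h₁.intervalIntegrable x y) (h₂.intervalIntegrable x y),
    ← h₁.sub_eq, ← h₂.sub_eq]
  ring

theorem const_mul (h : IsPrimitive p q) (c : ℂ) :
    IsPrimitive (fun x => c * p x) fun x => c * q x := by
  refine ⟨h.locallyIntegrable.smul c, fun x y => ?_⟩
  rw [intervalIntegral.integral_const_mul, ← h.sub_eq]
  ring

theorem conj (h : IsPrimitive p q) :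
    IsPrimitive (fun x => star (p x)) fun x => star (q x) := by
  refine ⟨fun x => ?_, fun x y => ?_⟩
  · obtain ⟨s, hs, hi⟩ := h.locallyIntegrable x
    exact ⟨s, hs, (LinearIsometryEquiv.integrable_comp_iff Complex.conjLIE).2 hi⟩
  · have := Complex.conjCLE.toContinuousLinearMap.intervalIntegral_comp_comm
      (h.intervalIntegrable x y)
    rw [← star_sub, h.sub_eq]
    exact this.symm

theorem absolutelyContinuousOnInterval (h : IsPrimitive p q) (a b : ℝ) :
    AbsolutelyContinuousOnInterval p a b := by
  have hre : AbsolutelyContinuousOnInterval (fun x => ∫ t in a..x, (q t).re) a b :=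
    IntervalIntegrable.absolutelyContinuousOnInterval_intervalIntegral
      ⟨(h.intervalIntegrable a b).1.re, (h.intervalIntegrable a b).2.re⟩ left_mem_uIcc
  have him : AbsolutelyContinuousOnInterval (fun x => ∫ t in a..x, (q t).im) a b :=
    IntervalIntegrable.absolutelyContinuousOnInterval_intervalIntegral
      ⟨(h.intervalIntegrable a b).1.im, (h.intervalIntegrable a b).2.im⟩ left_mem_uIcc
  have hc (c : ℂ) : AbsolutelyContinuousOnInterval (fun _ : ℝ => c) a b :=
    (contDiff_const (c := c)).contDiffOn.absolutelyContinuousOnInterval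
  have key := ((hc (p a)).add (hre.smul (hc 1))).add (him.smul (hc Complex.I))
  suffices p = ((fun _ => p a) + (fun x => ∫ t in a..x, (q t).re) • fun _ : ℝ => (1 : ℂ)) +
      (fun x => ∫ t in a..x, (q t).im) • fun _ : ℝ => Complex.I by
    rw [this]; exact key
  funext x
  have h1 : ∫ t in a..x, (q t).re = (∫ t in a..x, q t).re :=
    Complex.reCLM.intervalIntegral_comp_comm (h.intervalIntegrable a x)
  have h2 : ∫ t in a..x, (q t).im = (∫ t in a..x, q t).im :=
    Complex.imCLM.intervalIntegral_comp_comm (h.intervalIntegrable a x)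
  simp only [Pi.add_apply, Pi.smul_apply', h1, h2, Complex.real_smul, mul_one]
  rw [h.eq_add a x, add_assoc, Complex.re_add_im]

/-- The product rule for absolutely continuous functions. -/
theorem mul (h₁ : IsPrimitive p₁ q₁) (h₂ : IsPrimitive p₂ q₂) :
    IsPrimitive (fun x => p₁ x * p₂ x) fun x => q₁ x * p₂ x + p₁ x * q₂ x := by
  have hloc : LocallyIntegrable (fun x => q₁ x * p₂ x + p₁ x * q₂ x) volume := by
    intro x
    refine IntegrableAtFilter.add ?_ ?_
    · refine ⟨Icc (x - 1) (x + 1), Icc_mem_nhds (by linarith) (by linarith), ?_⟩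
      exact (h₁.locallyIntegrable.integrableOn_isCompact isCompact_Icc).mul_continuousOn
        h₂.continuous.continuousOn isCompact_Icc
    · refine ⟨Icc (x - 1) (x + 1), Icc_mem_nhds (by linarith) (by linarith), ?_⟩
      exact (h₂.locallyIntegrable.integrableOn_isCompact isCompact_Icc).continuousOn_mul
        h₁.continuous.continuousOn isCompact_Icc
  refine ⟨hloc, fun x y => ?_⟩
  have hP := IsPrimitive.of_integral hloc 0 x
  have hac : AbsolutelyContinuousOnInterval
      (p₁ • p₂ - fun z => 0 + ∫ t in x..z, (q₁ t * p₂ t + p₁ t * q₂ t)) x y :=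
    ((h₁.absolutelyContinuousOnInterval x y).smul (h₂.absolutelyContinuousOnInterval x y)).sub
      (hP.absolutelyContinuousOnInterval x y)
  have hder : ∀ᵐ z, z ∈ uIcc x y → HasDerivAt
      (p₁ • p₂ - fun z => 0 + ∫ t in x..z, (q₁ t * p₂ t + p₁ t * q₂ t)) 0 z := by
    filter_upwards [h₁.ae_hasDerivAt, h₂.ae_hasDerivAt, hP.ae_hasDerivAt] with z k1 k2 k3 _
    simpa using! (k1.mul k2).sub k3
  obtain ⟨C, hC⟩ := hac.const_of_ae_hasDerivAt_zero hder
  have e1 := hC x left_mem_uIcc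
  have e2 := hC y right_mem_uIcc
  simp only [Pi.sub_apply, smul_eq_mul, Pi.mul_apply, intervalIntegral.integral_same, zero_add,
    sub_zero] at e1 e2
  rw [e1, ← e2]
  ring

/-- Integration by parts against a `C¹` function with compact support. -/
theorem integral_mul_deriv (h : IsPrimitive p q) {φ : ℝ → ℂ} (hφ : ContDiff ℝ 1 φ)
    (hc : HasCompactSupport φ) : ∫ x, p x * deriv φ x = -∫ x, q x * φ x := by
  obtain ⟨R, hR⟩ := hc.isCompact.isBounded.subset_closedBall 0
  rw [Real.closedBall_eq_Icc] at hR
  have hout : ∀ x, x ∉ Ioc (-(|R| + 1)) (|R| + 1) → x ∉ tsupport φ := by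
    intro x hx hxs
    have h1 := hR hxs
    have := le_abs_self R
    simp only [mem_Icc, mem_Ioc] at h1 hx
    exact hx ⟨by linarith, by linarith⟩
  have hle : -(|R| + 1) ≤ |R| + 1 := by have := abs_nonneg R; linarith
  have hdc : Continuous (deriv φ) := hφ.continuous_deriv le_rfl
  have hφp : IsPrimitive φ (deriv φ) :=
    of_hasDerivAt (fun x => (hφ.differentiable (by norm_num) x).hasDerivAt)
      hdc
  have hmul := h.mul hφp
  have key := hmul.sub_eq (-(|R| + 1)) (|R| + 1)
  have hz1 : φ (|R| + 1) = 0 := by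
    refine image_eq_zero_of_notMem_tsupport fun hxs => ?_
    have h1 := (hR hxs).2
    have := le_abs_self R
    linarith
  have hz2 : φ (-(|R| + 1)) = 0 := by
    refine image_eq_zero_of_notMem_tsupport fun hxs => ?_
    have h1 := (hR hxs).1
    have := le_abs_self R
    linarith
  rw [hz1, hz2, mul_zero, mul_zero, sub_zero, intervalIntegral.integral_add,
    intervalIntegral.integral_of_le hle, intervalIntegral.integral_of_le hle,
    setIntegral_eq_integral_of_forall_compl_eq_zero,
    setIntegral_eq_integral_of_forall_compl_eq_zero] at key
  · rw [eq_neg_iff_add_eq_zero, add_comm]; exact key.symm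
  · intro x hx
    rw [show deriv φ x = 0 from
      image_eq_zero_of_notMem_tsupport fun hxs => hout x hx (tsupport_deriv_subset hxs), mul_zero]
  · intro x hx
    rw [image_eq_zero_of_notMem_tsupport (hout x hx), mul_zero]
  · exact (h.intervalIntegrable _ _).mul_continuousOn hφ.continuous.continuousOn
  · exact (h.continuous.mul hdc).intervalIntegrable _ _

end IsPrimitive

/-! ### Distributions on an interval and the weak Airy equation -/

/-- The test function on `Ω` given by a real-valued smooth function with compact support in `Ω`. -/
noncomputable def testOfReal {Ω : Opens ℝ} (f : ℝ → ℝ) (h₁ : ContDiff ℝ (⊤ : ℕ∞) f)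
    (h₂ : HasCompactSupport f) (h₃ : tsupport f ⊆ Ω) : 𝓓(Ω, ℂ) where
  toFun x := (f x : ℂ)
  contDiff' := Complex.ofRealCLM.contDiff.comp h₁
  hasCompactSupport' := h₂.comp_left (g := fun r : ℝ => (r : ℂ)) Complex.ofReal_zero
  tsupport_subset' :=
    (tsupport_comp_subset (g := fun r : ℝ => (r : ℂ)) Complex.ofReal_zero f).trans h₃

/-- Differentiation of test functions. -/
noncomputable def testDeriv (Ω : Opens ℝ) : 𝓓(Ω, ℂ) →ₗ[ℂ] 𝓓(Ω, ℂ) where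
  toFun φ :=
    { toFun := deriv φ
      contDiff' := (contDiff_infty_iff_deriv.1 φ.contDiff).2
      hasCompactSupport' := φ.hasCompactSupport.deriv
      tsupport_subset' := tsupport_deriv_subset.trans φ.tsupport_subset }
  map_add' φ ψ := by
    ext x
    exact deriv_add ((contDiff_infty_iff_deriv.1 φ.contDiff).1 x)
      ((contDiff_infty_iff_deriv.1 ψ.contDiff).1 x)
  map_smul' c φ := by
    ext x
    exact deriv_const_smul c ((contDiff_infty_iff_deriv.1 φ.contDiff).1 x)

@[simp]
theorem coe_testDeriv {Ω : Opens ℝ} (φ : 𝓓(Ω, ℂ)) : (testDeriv Ω φ : ℝ → ℂ) = deriv φ := rfl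

theorem integrable_mul_test {Ω : Opens ℝ} {f : ℝ → ℂ} (hf : LocallyIntegrable f volume)
    (φ : 𝓓(Ω, ℂ)) : Integrable (fun x => f x * φ x) := by
  simpa [mul_comm] using hf.integrable_smul_left_of_hasCompactSupport φ.continuous
    φ.hasCompactSupport

/-- The distribution on `Ω` given by a locally integrable function, as a linear functional. -/
noncomputable def pairing (Ω : Opens ℝ) (f : ℝ → ℂ) (hf : LocallyIntegrable f volume) :
    𝓓(Ω, ℂ) →ₗ[ℂ] ℂ where
  toFun φ := ∫ x, f x * φ x
  map_add' φ ψ := by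
    rw [← integral_add (integrable_mul_test hf φ) (integrable_mul_test hf ψ)]
    refine integral_congr_ae (ae_of_all _ fun x => ?_)
    exact mul_add _ _ _
  map_smul' c φ := by
    rw [RingHom.id_apply, smul_eq_mul, ← integral_const_mul]
    refine integral_congr_ae (ae_of_all _ fun x => ?_)
    exact mul_left_comm _ _ _

theorem pairing_apply {Ω : Opens ℝ} {f : ℝ → ℂ} (hf : LocallyIntegrable f volume)
    (φ : 𝓓(Ω, ℂ)) : pairing Ω f hf φ = ∫ x, f x * φ x := rfl

theorem IsPrimitive.pairing_testDeriv {Ω : Opens ℝ} {p q : ℝ → ℂ} (h : IsPrimitive p q)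
    (φ : 𝓓(Ω, ℂ)) :
    pairing Ω p h.continuous.locallyIntegrable (testDeriv Ω φ) =
      -pairing Ω q h.locallyIntegrable φ :=
  h.integral_mul_deriv (φ.contDiff.of_le (by exact_mod_cast le_top)) φ.hasCompactSupport

/-- The fundamental lemma of the calculus of variations. -/
theorem ae_eq_of_pairing_eq {Ω : Opens ℝ} {f g : ℝ → ℂ} (hf : LocallyIntegrable f volume)
    (hg : LocallyIntegrable g volume) (h : pairing Ω f hf = pairing Ω g hg) :
    f =ᵐ[volume.restrict (Ω : Set ℝ)] g := by
  rw [EventuallyEq, ae_restrict_iff' Ω.isOpen.measurableSet]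
  have hfg : LocallyIntegrable (fun x => f x - g x) volume := hf.sub hg
  have := Ω.isOpen.ae_eq_zero_of_integral_contDiff_smul_eq_zero (hfg.locallyIntegrableOn _)
    (fun r h₁ h₂ h₃ => by
      have key := LinearMap.congr_fun h (testOfReal r h₁ h₂ h₃)
      rw [pairing_apply, pairing_apply, ← sub_eq_zero, ← integral_sub
        (integrable_mul_test hf _) (integrable_mul_test hg _)] at key
      rw [← key]
      refine integral_congr_ae (ae_of_all _ fun x => ?_)
      change r x • (f x - g x) = f x * (r x : ℂ) - g x * (r x : ℂ)
      rw [Complex.real_smul]; ring)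
  filter_upwards [this] with x hx hxΩ
  exact sub_eq_zero.1 (hx hxΩ)

theorem exists_test_integral_eq_one {Ω : Opens ℝ} (hne : (Ω : Set ℝ).Nonempty) :
    ∃ ρ : 𝓓(Ω, ℂ), ∫ x, ρ x = 1 := by
  obtain ⟨a, ha⟩ := hne
  obtain ⟨r, hr, hrΩ⟩ := Metric.isOpen_iff.1 Ω.isOpen a ha
  let b : ContDiffBump a := ⟨r / 4, r / 2, by positivity, by linarith⟩
  refine ⟨testOfReal (b.normed volume) b.contDiff_normed b.hasCompactSupport_normed ?_, ?_⟩
  · rw [b.tsupport_normed_eq]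
    exact (Metric.closedBall_subset_ball (by change r / 2 < r; linarith)).trans hrΩ
  · change ∫ x, ((b.normed volume x : ℝ) : ℂ) = 1
    rw [integral_complex_ofReal, b.integral_normed, Complex.ofReal_one]

/-- On an interval, a test function with integral zero is the derivative of a test function. -/
theorem exists_testDeriv_eq {Ω : Opens ℝ} (hΩ : (Ω : Set ℝ).OrdConnected) (ψ : 𝓓(Ω, ℂ))
    (hψ : ∫ x, ψ x = 0) : ∃ φ : 𝓓(Ω, ℂ), testDeriv Ω φ = ψ := by
  rcases (tsupport ψ).eq_empty_or_nonempty with he | hne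
  · refine ⟨0, ?_⟩
    rw [map_zero]
    ext x
    exact (image_eq_zero_of_notMem_tsupport (by rw [he]; exact notMem_empty x)).symm
  obtain ⟨c, hc, hcmin⟩ := ψ.hasCompactSupport.isCompact.exists_isMinOn hne continuousOn_id
  obtain ⟨d, hd, hdmax⟩ := ψ.hasCompactSupport.isCompact.exists_isMaxOn hne continuousOn_id
  have hsub : tsupport ψ ⊆ Icc c d := fun x hx => ⟨hcmin hx, hdmax hx⟩
  have hcd : c ≤ d := hcmin hd
  have hder : ∀ x, HasDerivAt (fun x => ∫ t in c..x, ψ t) (ψ x) x := fun x =>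
    (ψ.continuous.integral_hasStrictDerivAt c x).hasDerivAt
  have hderiv : deriv (fun x => ∫ t in c..x, ψ t) = ψ := funext fun x => (hder x).deriv
  have hzero : ∀ x ∉ Icc c d, ∫ t in c..x, ψ t = 0 := by
    intro x hx
    rcases lt_or_ge x c with h | h
    · refine intervalIntegral.integral_zero_ae ?_
      have hne : ∀ᵐ t : ℝ, t ≠ c := by simp [ae_iff, measure_singleton]
      filter_upwards [hne] with t htc ht
      refine image_eq_zero_of_notMem_tsupport fun hts => htc ?_
      rw [uIoc_of_ge h.le] at ht
      exact le_antisymm ht.2 (hsub hts).1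
    · have hxd : d < x := by
        by_contra hcon
        exact hx ⟨h, not_lt.1 hcon⟩
      rw [intervalIntegral.integral_of_le h, ← integral_Icc_eq_integral_Ioc,
        setIntegral_eq_integral_of_forall_compl_eq_zero, hψ]
      intro t ht
      exact image_eq_zero_of_notMem_tsupport fun hts =>
        ht ⟨(hsub hts).1, (hsub hts).2.trans hxd.le⟩
  have hts : tsupport (fun x => ∫ t in c..x, ψ t) ⊆ Icc c d :=
    closure_minimal (fun x hx => by
      by_contra hcon
      exact hx (hzero x hcon)) isClosed_Icc
  refine ⟨⟨fun x => ∫ t in c..x, ψ t, ?_, ?_, ?_⟩, ?_⟩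
  · refine contDiff_infty_iff_deriv.2 ⟨fun x => (hder x).differentiableAt, ?_⟩
    rw [hderiv]
    exact ψ.contDiff
  · exact HasCompactSupport.of_support_subset_isCompact isCompact_Icc
      (subset_closure.trans hts)
  · exact hts.trans (hΩ.out (ψ.tsupport_subset hc) (ψ.tsupport_subset hd))
  · ext x
    exact (hder x).deriv

/-- A distribution on an interval whose derivative vanishes is constant. -/
theorem exists_eq_pairing_const {Ω : Opens ℝ} (hΩ : (Ω : Set ℝ).OrdConnected)
    (hne : (Ω : Set ℝ).Nonempty) (T : 𝓓(Ω, ℂ) →ₗ[ℂ] ℂ) (hT : ∀ φ, T (testDeriv Ω φ) = 0) :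
    ∃ c : ℂ, T = pairing Ω (fun _ => c) continuous_const.locallyIntegrable := by
  obtain ⟨ρ, hρ⟩ := exists_test_integral_eq_one hne
  refine ⟨T ρ, LinearMap.ext fun ψ => ?_⟩
  have hint (φ : 𝓓(Ω, ℂ)) : Integrable (φ : ℝ → ℂ) :=
    φ.continuous.integrable_of_hasCompactSupport φ.hasCompactSupport
  obtain ⟨φ, hφ⟩ := exists_testDeriv_eq hΩ (ψ - (∫ x, ψ x) • ρ) (by
    have : ∫ x, (ψ x - (∫ y, ψ y) * ρ x) = 0 := by
      rw [integral_sub (hint ψ) ((hint ρ).const_mul _), integral_const_mul, hρ, mul_one, sub_self]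
    exact this)
  have := hT φ
  rw [hφ, map_sub, map_smul, sub_eq_zero, smul_eq_mul] at this
  rw [this, pairing_apply, integral_const_mul, mul_comm]

/-- Distributional solutions `u ∈ L¹_loc` of `α u''' + β u' = f` with `f ∈ L¹_loc` on an interval
are twice continuously differentiable with absolutely continuous second derivative. The family
`g` collects a representative `g 0` and its derivatives `g 1`, `g 2`, `g 3`. -/
theorem exists_primitives_of_weak_airy {Ω : Opens ℝ} (hΩ : (Ω : Set ℝ).OrdConnected)
    (hne : (Ω : Set ℝ).Nonempty) {u f : ℝ → ℂ} (hu : LocallyIntegrable u volume)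
    (hf : LocallyIntegrable f volume) {a b : ℂ} (ha : a ≠ 0)
    (h : ∀ φ : 𝓓(Ω, ℂ), a * pairing Ω u hu (testDeriv Ω (testDeriv Ω (testDeriv Ω φ))) +
      b * pairing Ω u hu (testDeriv Ω φ) = -pairing Ω f hf φ) :
    ∃ g : ℕ → ℝ → ℂ, (∀ j < 3, IsPrimitive (g j) (g (j + 1))) ∧
      u =ᵐ[volume.restrict (Ω : Set ℝ)] g 0 ∧ ∀ x ∈ Ω, a * g 3 x + b * g 1 x = f x := by
  set D := testDeriv Ω with hD
  have hF := IsPrimitive.of_integral hf 0 0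
  set F : ℝ → ℂ := fun x => 0 + ∫ t in (0 : ℝ)..x, f t
  -- Three integrations of the equation, each producing a constant.
  obtain ⟨c, hc⟩ := exists_eq_pairing_const hΩ hne
    (a • (pairing Ω u hu ∘ₗ D ∘ₗ D) + b • pairing Ω u hu -
      pairing Ω F hF.continuous.locallyIntegrable) (fun φ => by
        simp only [LinearMap.sub_apply, LinearMap.add_apply, LinearMap.smul_apply,
          LinearMap.comp_apply, smul_eq_mul]
        rw [h φ, hF.pairing_testDeriv, sub_self])
  have hcF : LocallyIntegrable (fun x => F x + c) volume :=
    (hF.continuous.add continuous_const).locallyIntegrable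
  have hh : LocallyIntegrable (fun x => F x + c - b * u x) volume := hcF.sub (hu.smul b)
  have e₁ (φ : 𝓓(Ω, ℂ)) : a * pairing Ω u hu (D (D φ)) = pairing Ω _ hh φ := by
    have h₁ := LinearMap.congr_fun hc φ
    have h₂ : pairing Ω _ hh φ = pairing Ω F hF.continuous.locallyIntegrable φ +
        pairing Ω (fun _ => c) continuous_const.locallyIntegrable φ - b * pairing Ω u hu φ := by
      have i₁ := integrable_mul_test hF.continuous.locallyIntegrable φ
      have i₂ := integrable_mul_test (continuous_const (y := c)).locallyIntegrable φ
      have i₃ : Integrable fun x => F x * φ x + c * φ x := i₁.add i₂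
      simp only [pairing_apply]
      rw [← integral_const_mul, ← integral_add i₁ i₂,
        ← integral_sub i₃ ((integrable_mul_test hu φ).const_mul b)]
      exact integral_congr_ae (ae_of_all _ fun x => by ring)
    simp only [LinearMap.sub_apply, LinearMap.add_apply, LinearMap.smul_apply,
      LinearMap.comp_apply, smul_eq_mul] at h₁
    linear_combination h₁ - h₂
  have hH := IsPrimitive.of_integral hh 0 0
  set H : ℝ → ℂ := fun x => 0 + ∫ t in (0 : ℝ)..x, (F t + c - b * u t)
  obtain ⟨c₂, hc₂⟩ := exists_eq_pairing_const hΩ hne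
    (a • (pairing Ω u hu ∘ₗ D) + pairing Ω H hH.continuous.locallyIntegrable) (fun φ => by
        simp only [LinearMap.add_apply, LinearMap.smul_apply, LinearMap.comp_apply, smul_eq_mul]
        rw [e₁ φ, hH.pairing_testDeriv, add_neg_cancel])
  have hkc : Continuous fun x => c₂ - H x := continuous_const.sub hH.continuous
  have e₂ (φ : 𝓓(Ω, ℂ)) : a * pairing Ω u hu (D φ) = pairing Ω _ hkc.locallyIntegrable φ := by
    have h₁ := LinearMap.congr_fun hc₂ φ
    have h₂ : pairing Ω _ hkc.locallyIntegrable φ =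
        pairing Ω (fun _ => c₂) continuous_const.locallyIntegrable φ -
          pairing Ω H hH.continuous.locallyIntegrable φ := by
      simp only [pairing_apply]
      rw [← integral_sub (integrable_mul_test continuous_const.locallyIntegrable φ)
        (integrable_mul_test hH.continuous.locallyIntegrable φ)]
      exact integral_congr_ae (ae_of_all _ fun x => by ring)
    simp only [LinearMap.add_apply, LinearMap.smul_apply, LinearMap.comp_apply, smul_eq_mul] at h₁
    linear_combination h₁ - h₂
  have hK := IsPrimitive.of_integral hkc.locallyIntegrable 0 0
  set K : ℝ → ℂ := fun x => 0 + ∫ t in (0 : ℝ)..x, (c₂ - H t)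
  obtain ⟨c₃, hc₃⟩ := exists_eq_pairing_const hΩ hne
    (a • pairing Ω u hu + pairing Ω K hK.continuous.locallyIntegrable) (fun φ => by
        simp only [LinearMap.add_apply, LinearMap.smul_apply, smul_eq_mul]
        rw [e₂ φ, hK.pairing_testDeriv, add_neg_cancel])
  have hgc : Continuous fun x => a⁻¹ * (c₃ - K x) :=
    continuous_const.mul (continuous_const.sub hK.continuous)
  have hug : u =ᵐ[volume.restrict (Ω : Set ℝ)] fun x => a⁻¹ * (c₃ - K x) := by
    refine ae_eq_of_pairing_eq hu hgc.locallyIntegrable (LinearMap.ext fun φ => ?_)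
    have h₁ := LinearMap.congr_fun hc₃ φ
    have h₂ : pairing Ω _ hgc.locallyIntegrable φ =
        a⁻¹ * (pairing Ω (fun _ => c₃) continuous_const.locallyIntegrable φ -
          pairing Ω K hK.continuous.locallyIntegrable φ) := by
      simp only [pairing_apply]
      rw [← integral_sub (integrable_mul_test continuous_const.locallyIntegrable φ)
        (integrable_mul_test hK.continuous.locallyIntegrable φ), ← integral_const_mul]
      exact integral_congr_ae (ae_of_all _ fun x => by ring)
    simp only [LinearMap.add_apply, LinearMap.smul_apply, smul_eq_mul] at h₁
    rw [h₂, ← h₁]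
    field_simp
    ring
  -- The continuous representative just found is `C²` on `Ω` only. Outside `Ω` it is replaced by
  -- the solution of the integrated equation, so that the derivatives exist on all of `ℝ`.
  obtain ⟨x₀, hx₀⟩ := hne
  set G : ℝ → ℂ := fun x => a⁻¹ * (c₃ - K x)
  have hG : IsPrimitive G fun x => a⁻¹ * (H x - c₂) := by
    refine ⟨(continuous_const.mul (hH.continuous.sub continuous_const)).locallyIntegrable,
      fun x y => ?_⟩
    have e : (fun x => a⁻¹ * (H x - c₂)) = fun x => (-a⁻¹) * (c₂ - H x) := by
      funext x; ring
    rw [e, intervalIntegral.integral_const_mul, ← hK.sub_eq]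
    simp only [G]
    ring
  have hg₂ : IsPrimitive (fun x => a⁻¹ * (F x + -b * G x + c))
      fun x => a⁻¹ * (f x + -b * (a⁻¹ * (H x - c₂)) + 0) :=
    ((hF.add (hG.const_mul (-b))).add
      (IsPrimitive.of_hasDerivAt (fun x => hasDerivAt_const x c) continuous_const)).const_mul a⁻¹
  have hg₁ := IsPrimitive.of_integral hg₂.continuous.locallyIntegrable (a⁻¹ * (H x₀ - c₂)) x₀
  set g₂ : ℝ → ℂ := fun x => a⁻¹ * (F x + -b * G x + c)
  have hg₀ := IsPrimitive.of_integral hg₁.continuous.locallyIntegrable (G x₀) x₀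
  set g₁ : ℝ → ℂ := fun x => a⁻¹ * (H x₀ - c₂) + ∫ t in x₀..x, g₂ t
  set g₀ : ℝ → ℂ := fun x => G x₀ + ∫ t in x₀..x, g₁ t
  have hsub (x : ℝ) (hx : x ∈ Ω) : uIcc x₀ x ⊆ Ω := hΩ.uIcc_subset hx₀ hx
  have h₁ (x : ℝ) (hx : x ∈ Ω) : g₁ x = a⁻¹ * (H x - c₂) := by
    have : ∫ t in x₀..x, g₂ t = ∫ t in x₀..x, a⁻¹ * (F t + c - b * u t) := by
      refine intervalIntegral.integral_congr_ae ?_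
      have := (ae_restrict_iff' Ω.isOpen.measurableSet).1 hug
      filter_upwards [this] with t ht htx
      rw [ht (hsub x hx (uIoc_subset_uIcc htx))]
      simp only [g₂]
      ring
    simp only [g₁]
    rw [this, intervalIntegral.integral_const_mul, ← hH.sub_eq]
    ring
  have h₀ (x : ℝ) (hx : x ∈ Ω) : g₀ x = G x := by
    have : ∫ t in x₀..x, g₁ t = ∫ t in x₀..x, a⁻¹ * (H t - c₂) :=
      intervalIntegral.integral_congr fun t ht => h₁ t (hsub x hx ht)
    simp only [g₀]
    rw [this, ← hG.sub_eq]
    ring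
  refine ⟨fun j => match j with
    | 0 => g₀
    | 1 => g₁
    | 2 => g₂
    | _ => fun x => a⁻¹ * (f x + -b * (a⁻¹ * (H x - c₂)) + 0), ?_, ?_, ?_⟩
  · intro j hj
    interval_cases j
    · exact hg₀
    · exact hg₁
    · exact hg₂
  · filter_upwards [hug, ae_restrict_mem Ω.isOpen.measurableSet] with x hx hxΩ
    rw [hx]
    exact (h₀ x hxΩ).symm
  · intro x hx
    change a * (a⁻¹ * (f x + -b * (a⁻¹ * (H x - c₂)) + 0)) + b * g₁ x = f x
    rw [h₁ x hx]
    field_simp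
    ring

/-! ### Square integrability of derivatives on half-lines and bounded intervals -/

theorem sq_intervalIntegral_le {h : ℝ → ℝ} {x : ℝ} (h₁ : IntervalIntegrable h volume x (x + 1))
    (h₂ : IntervalIntegrable (fun t => h t ^ 2) volume x (x + 1)) :
    (∫ t in x..x + 1, h t) ^ 2 ≤ ∫ t in x..x + 1, h t ^ 2 := by
  set m := ∫ t in x..x + 1, h t with hm
  have h0 : 0 ≤ ∫ t in x..x + 1, (h t - m) ^ 2 :=
    intervalIntegral.integral_nonneg (by linarith) fun t _ => sq_nonneg _
  have e : ∫ t in x..x + 1, (h t - m) ^ 2 = ∫ t in x..x + 1, (h t ^ 2 - 2 * m * h t + m ^ 2) :=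
    intervalIntegral.integral_congr fun t _ => by ring
  rw [e, intervalIntegral.integral_add (h₂.sub (h₁.const_mul _)) intervalIntegrable_const,
    intervalIntegral.integral_sub h₂ (h₁.const_mul _), intervalIntegral.integral_const_mul,
    ← hm, intervalIntegral.integral_const] at h0
  simp only [add_sub_cancel_left, one_smul] at h0
  nlinarith

/-- A continuous function dominated by the averages over `[x, x + 1]` of a square integrable
function is square integrable. -/
theorem memLp_of_norm_le_intervalIntegral {a : ℝ} {v : ℝ → ℂ} (hv : Continuous v) {h : ℝ → ℝ}
    (hh : MemLp h 2 (volume.restrict (Ioi a)))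
    (hb : ∀ x, a < x → ‖v x‖ ≤ ∫ t in x..x + 1, h t) :
    MemLp v 2 (volume.restrict (Ioi a)) := by
  have hsq : IntegrableOn (fun t => h t ^ 2) (Ioi a) := hh.integrable_sq
  set H : ℝ → ℝ := (Ioi a).indicator fun t => h t ^ 2 with hHdef
  have hH : Integrable H := hsq.integrable_indicator measurableSet_Ioi
  have hk : Integrable ((Ioc (-1 : ℝ) 0).indicator fun _ => (1 : ℝ)) :=
    (integrable_indicator_iff measurableSet_Ioc).2 (integrableOn_const (by simp))
  -- The averages of `H` are the values of the convolution with the indicator of `(-1, 0]`.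
  have hconv := hk.integrable_convolution (ContinuousLinearMap.mul ℝ ℝ) hH
  have hcx (x : ℝ) : convolution ((Ioc (-1 : ℝ) 0).indicator fun _ => (1 : ℝ)) H
      (ContinuousLinearMap.mul ℝ ℝ) volume x = ∫ t in x..x + 1, H t := by
    have e : ∀ t, (ContinuousLinearMap.mul ℝ ℝ) ((Ioc (-1 : ℝ) 0).indicator (fun _ => (1 : ℝ)) t)
        (H (x - t)) = (Ioc (-1 : ℝ) 0).indicator (fun t => H (x - t)) t := by
      intro t
      by_cases ht : t ∈ Ioc (-1 : ℝ) 0 <;> simp [ht]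
    rw [convolution_def]
    simp_rw [e]
    rw [integral_indicator measurableSet_Ioc,
      ← intervalIntegral.integral_of_le (by norm_num : (-1 : ℝ) ≤ 0),
      intervalIntegral.integral_comp_sub_left]
    simp
  have hsub (x : ℝ) (hx : a < x) : Ioc x (x + 1) ⊆ Ioi a := fun t ht => hx.trans ht.1
  rw [memLp_two_iff_integrable_sq_norm hv.aestronglyMeasurable]
  refine Integrable.mono' hconv.integrableOn
    ((hv.norm.pow 2).aestronglyMeasurable) ?_
  filter_upwards [ae_restrict_mem measurableSet_Ioi] with x hx
  rw [hcx, Real.norm_of_nonneg (by positivity)]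
  have e : ∫ t in x..x + 1, H t = ∫ t in x..x + 1, h t ^ 2 := by
    refine intervalIntegral.integral_congr_ae (ae_of_all _ fun t ht => ?_)
    rw [uIoc_of_le (by linarith)] at ht
    exact indicator_of_mem (hsub x hx ht) _
  have i₂ : IntervalIntegrable (fun t => h t ^ 2) volume x (x + 1) :=
    (intervalIntegrable_iff_integrableOn_Ioc_of_le (by linarith)).2 (hsq.mono_set (hsub x hx))
  have i₁ : IntervalIntegrable h volume x (x + 1) := by
    refine (intervalIntegrable_iff_integrableOn_Ioc_of_le (by linarith)).2 ?_
    have : MemLp h 2 (volume.restrict (Ioc x (x + 1))) :=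
      hh.mono_measure (Measure.restrict_mono (hsub x hx) le_rfl)
    exact this.integrable (by norm_num)
  rw [e]
  exact (pow_le_pow_left₀ (norm_nonneg _) (hb x hx) 2).trans (sq_intervalIntegral_le i₁ i₂)

/-- Integration by parts on an interval, when one factor vanishes at both ends. -/
theorem IsPrimitive.intervalIntegral_mul_eq_neg {p q φ φ' : ℝ → ℂ} (h : IsPrimitive p q)
    (hφ : IsPrimitive φ φ') {c d : ℝ} (hc : φ c = 0) (hd : φ d = 0) :
    ∫ t in c..d, p t * φ' t = -∫ t in c..d, q t * φ t := by
  have key := (h.mul hφ).sub_eq c d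
  rw [hc, hd, mul_zero, mul_zero, sub_zero, intervalIntegral.integral_add
    ((h.intervalIntegrable c d).mul_continuousOn hφ.continuous.continuousOn)
    ((hφ.intervalIntegrable c d).continuousOn_mul h.continuous.continuousOn)] at key
  rw [eq_neg_iff_add_eq_zero, add_comm]
  exact key.symm

/-- The weight `30 t² (1 - t)²` with its first two derivatives. -/
theorem exists_weight : ∃ η η' η'' : ℝ → ℂ, (∀ t, HasDerivAt η (η' t) t) ∧
    (∀ t, HasDerivAt η' (η'' t) t) ∧ Continuous η'' ∧ η 0 = 0 ∧ η 1 = 0 ∧ η' 0 = 0 ∧ η' 1 = 0 ∧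
    ∫ t in (0 : ℝ)..1, η t = 1 := by
  refine ⟨fun t => ((30 * (t ^ 2 - 2 * t ^ 3 + t ^ 4) : ℝ) : ℂ),
    fun t => ((30 * (2 * t - 6 * t ^ 2 + 4 * t ^ 3) : ℝ) : ℂ),
    fun t => ((30 * (2 - 12 * t + 12 * t ^ 2) : ℝ) : ℂ), fun t => ?_, fun t => ?_,
    by fun_prop, by norm_num, by norm_num, by norm_num, by norm_num, ?_⟩
  · refine HasDerivAt.ofReal_comp ?_
    have := ((((hasDerivAt_id t).pow 2).sub (((hasDerivAt_id t).pow 3).const_mul 2)).add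
      ((hasDerivAt_id t).pow 4)).const_mul 30
    convert! this using 1
    simp; ring
  · refine HasDerivAt.ofReal_comp ?_
    have := ((((hasDerivAt_id t).const_mul 2).sub (((hasDerivAt_id t).pow 2).const_mul 6)).add
      (((hasDerivAt_id t).pow 3).const_mul 4)).const_mul 30
    convert! this using 1
    simp; ring
  · rw [intervalIntegral.integral_ofReal, intervalIntegral.integral_const_mul,
      intervalIntegral.integral_add (Continuous.intervalIntegrable (by fun_prop) _ _)
        (Continuous.intervalIntegrable (by fun_prop) _ _),
      intervalIntegral.integral_sub (Continuous.intervalIntegrable (by fun_prop) _ _)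
        (Continuous.intervalIntegrable (by fun_prop) _ _),
      intervalIntegral.integral_const_mul, integral_pow, integral_pow, integral_pow]
    norm_num

theorem norm_intervalIntegral_mul_le {g κ : ℝ → ℂ} (hg : LocallyIntegrable g volume) {x M : ℝ}
    (hM : ∀ t ∈ Icc x (x + 1), ‖κ t‖ ≤ M) :
    ‖∫ t in x..x + 1, g t * κ t‖ ≤ ∫ t in x..x + 1, M * ‖g t‖ := by
  refine intervalIntegral.norm_integral_le_of_norm_le (by linarith) (ae_of_all _ fun t ht => ?_)
    ((intervalIntegrable_of_locallyIntegrable hg x (x + 1)).norm.const_mul M)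
  rw [norm_mul, mul_comm]
  exact mul_le_mul_of_nonneg_right (hM t (Ioc_subset_Icc_self ht)) (norm_nonneg _)

/-- The value at `x` of an absolutely continuous function is controlled by a weighted average over
`[x, x + 1]` and by the derivative there. -/
theorem IsPrimitive.norm_le {v f η : ℝ → ℂ} (h : IsPrimitive v f) (hη : Continuous η)
    (hη₁ : ∫ t in (0 : ℝ)..1, η t = 1) {M : ℝ} (hM : ∀ t ∈ Icc (0 : ℝ) 1, ‖η t‖ ≤ M) (x : ℝ) :
    ‖v x‖ ≤ ‖∫ t in x..x + 1, v t * η (t - x)‖ + ∫ t in x..x + 1, M * ‖f t‖ := by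
  have hηx : Continuous fun t => η (t - x) := by fun_prop
  have hM' : ∀ t ∈ Icc x (x + 1), ‖η (t - x)‖ ≤ M := fun t ht =>
    hM _ ⟨by linarith [ht.1], by linarith [ht.2]⟩
  have hone : ∫ t in x..x + 1, η (t - x) = 1 := by
    rw [intervalIntegral.integral_comp_sub_right]
    simpa using hη₁
  have e : v x = (∫ t in x..x + 1, v t * η (t - x)) -
      ∫ t in x..x + 1, (v t - v x) * η (t - x) := by
    have i₁ : Continuous fun t => v t * η (t - x) := h.continuous.mul hηx
    have i₂ : Continuous fun t => (v t - v x) * η (t - x) :=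
      (h.continuous.sub continuous_const).mul hηx
    rw [← intervalIntegral.integral_sub (i₁.intervalIntegrable _ _) (i₂.intervalIntegrable _ _)]
    simp_rw [← sub_mul, sub_sub_cancel]
    rw [intervalIntegral.integral_const_mul, hone, mul_one]
  have hle : x ≤ x + 1 := by linarith
  have hfi := (h.intervalIntegrable x (x + 1)).norm
  have hM0 : 0 ≤ M := (norm_nonneg _).trans (hM 0 ⟨le_rfl, zero_le_one⟩)
  have hb : ‖∫ t in x..x + 1, (v t - v x) * η (t - x)‖ ≤ ∫ t in x..x + 1, M * ‖f t‖ := by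
    have := intervalIntegral.norm_integral_le_of_norm_le_const (a := x) (b := x + 1)
      (C := M * ∫ t in x..x + 1, ‖f t‖) (f := fun t => (v t - v x) * η (t - x)) fun t ht => by
        rw [uIoc_of_le hle] at ht
        rw [norm_mul, mul_comm, h.sub_eq]
        refine mul_le_mul (hM' t (Ioc_subset_Icc_self ht)) ?_ (norm_nonneg _) hM0
        refine (intervalIntegral.norm_integral_le_integral_norm ht.1.le).trans ?_
        exact intervalIntegral.integral_mono_interval le_rfl ht.1.le ht.2
          (ae_of_all _ fun t => norm_nonneg _) hfi
    rw [intervalIntegral.integral_const_mul]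
    simpa using this
  rw [e]
  exact (norm_sub_le _ _).trans (add_le_add_right hb _)

/-- On a half-line, an absolutely continuous function with square integrable derivative is
square integrable if its weighted averages are controlled by a square integrable function. -/
theorem IsPrimitive.memLp_Ioi {a : ℝ} {v f g η κ : ℝ → ℂ} (h : IsPrimitive v f)
    (hη : Continuous η) (hη₁ : ∫ t in (0 : ℝ)..1, η t = 1) (hκ : Continuous κ)
    (hg : LocallyIntegrable g volume) (hg₂ : MemLp g 2 (volume.restrict (Ioi a)))
    (hf₂ : MemLp f 2 (volume.restrict (Ioi a)))
    (he : ∀ x, ∫ t in x..x + 1, v t * η (t - x) = ∫ t in x..x + 1, g t * κ (t - x)) :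
    MemLp v 2 (volume.restrict (Ioi a)) := by
  obtain ⟨M, hM⟩ := isCompact_Icc.exists_bound_of_continuousOn (s := Icc (0 : ℝ) 1) hη.continuousOn
  obtain ⟨N, hN⟩ := isCompact_Icc.exists_bound_of_continuousOn (s := Icc (0 : ℝ) 1) hκ.continuousOn
  refine memLp_of_norm_le_intervalIntegral h.continuous
    ((hg₂.norm.const_mul N).add (hf₂.norm.const_mul M)) fun x _ => ?_
  refine (h.norm_le hη hη₁ hM x).trans ?_
  rw [he x]
  have := norm_intervalIntegral_mul_le (κ := fun t => κ (t - x)) hg (x := x) (M := N)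
    fun t ht => hN _ ⟨by linarith [ht.1], by linarith [ht.2]⟩
  refine (add_le_add_left this _).trans (le_of_eq ?_)
  rw [← intervalIntegral.integral_add
    ((intervalIntegrable_of_locallyIntegrable hg _ _).norm.const_mul N)
    ((h.intervalIntegrable _ _).norm.const_mul M)]
  rfl

/-- The interpolation estimate on a half-line: if `u` and `α u''' + β u'` are square integrable,
then so are `u'`, `u''` and `u'''`. -/
theorem memLp_of_airy_Ioi {a : ℝ} {g : ℕ → ℝ → ℂ} (hg : ∀ j < 3, IsPrimitive (g j) (g (j + 1)))
    {α β : ℂ} (hα : α ≠ 0) (h₀ : MemLp (g 0) 2 (volume.restrict (Ioi a)))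
    (hf : MemLp (fun x => α * g 3 x + β * g 1 x) 2 (volume.restrict (Ioi a))) :
    ∀ j ≤ 3, MemLp (g j) 2 (volume.restrict (Ioi a)) := by
  obtain ⟨η, η', η'', hη, hη', hc, h0, h1, h0', h1', hone⟩ := exists_weight
  have hcη : Continuous η := continuous_iff_continuousAt.2 fun t => (hη t).continuousAt
  have hcη' : Continuous η' := continuous_iff_continuousAt.2 fun t => (hη' t).continuousAt
  have hp (x : ℝ) : IsPrimitive (fun t => η (t - x)) fun t => η' (t - x) :=
    IsPrimitive.of_hasDerivAt (fun t => (hη (t - x)).comp_sub_const t x) (by fun_prop)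
  have hp' (x : ℝ) : IsPrimitive (fun t => η' (t - x)) fun t => η'' (t - x) :=
    IsPrimitive.of_hasDerivAt (fun t => (hη' (t - x)).comp_sub_const t x) (by fun_prop)
  have e₁ (j : ℕ) (hj : j < 3) (x : ℝ) : ∫ t in x..x + 1, g (j + 1) t * η (t - x) =
      -∫ t in x..x + 1, g j t * η' (t - x) := by
    rw [(hg j hj).intervalIntegral_mul_eq_neg (hp x) (by simpa using h0) (by simpa using h1),
      neg_neg]
  have e₂ (x : ℝ) : ∫ t in x..x + 1, g 1 t * η' (t - x) =
      -∫ t in x..x + 1, g 0 t * η'' (t - x) := by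
    rw [(hg 0 (by norm_num)).intervalIntegral_mul_eq_neg (hp' x) (by simpa using h0')
      (by simpa using h1'), neg_neg]
  have c0 := (hg 0 (by norm_num)).continuous
  have c1 := (hg 1 (by norm_num)).continuous
  have c2 := (hg 2 (by norm_num)).continuous
  have hv := ((hg 2 (by norm_num)).const_mul α).add ((hg 0 (by norm_num)).const_mul β)
  have hv₂ : MemLp (fun x => α * g 2 x + β * g 0 x) 2 (volume.restrict (Ioi a)) := by
    refine hv.memLp_Ioi hcη hone (κ := fun t => α * η'' t + β * η t) (by fun_prop)
      c0.locallyIntegrable h₀ hf fun x => ?_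
    have i (p q : ℝ → ℂ) (hp : Continuous p) (hq : Continuous q) (c : ℂ) :
        IntervalIntegrable (fun t => c * (p t * q (t - x))) volume x (x + 1) := by
      have : Continuous fun t => c * (p t * q (t - x)) := by fun_prop
      exact this.intervalIntegrable _ _
    have l : ∫ t in x..x + 1, (α * g 2 t + β * g 0 t) * η (t - x) =
        α * (∫ t in x..x + 1, g 2 t * η (t - x)) + β * ∫ t in x..x + 1, g 0 t * η (t - x) := by
      rw [← intervalIntegral.integral_const_mul, ← intervalIntegral.integral_const_mul,
        ← intervalIntegral.integral_add (i _ _ c2 hcη α) (i _ _ c0 hcη β)]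
      exact intervalIntegral.integral_congr fun t _ => by ring
    have r : ∫ t in x..x + 1, g 0 t * (α * η'' (t - x) + β * η (t - x)) =
        α * (∫ t in x..x + 1, g 0 t * η'' (t - x)) + β * ∫ t in x..x + 1, g 0 t * η (t - x) := by
      rw [← intervalIntegral.integral_const_mul, ← intervalIntegral.integral_const_mul,
        ← intervalIntegral.integral_add (i _ _ c0 hc α) (i _ _ c0 hcη β)]
      exact intervalIntegral.integral_congr fun t _ => by ring
    rw [l, r, e₁ 1 (by norm_num) x, e₂ x, neg_neg]
  have h₂ : MemLp (g 2) 2 (volume.restrict (Ioi a)) := by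
    convert (hv₂.sub (h₀.const_mul β)).const_mul α⁻¹ using 1
    funext x
    simp only [Pi.sub_apply]
    field_simp
    ring
  have h₁ : MemLp (g 1) 2 (volume.restrict (Ioi a)) := by
    refine (hg 1 (by norm_num)).memLp_Ioi hcη hone (κ := fun t => -η' t) (by fun_prop)
      c0.locallyIntegrable h₀ h₂ fun x => ?_
    rw [e₁ 0 (by norm_num) x]
    simp
  have h₃ : MemLp (g 3) 2 (volume.restrict (Ioi a)) := by
    convert (hf.sub (h₁.const_mul β)).const_mul α⁻¹ using 1
    funext x
    simp only [Pi.sub_apply]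
    field_simp
    ring
  intro j hj
  interval_cases j <;> assumption

theorem memLp_Ioo_of_continuous {g : ℝ → ℂ} (hg : Continuous g) (a b : ℝ) :
    MemLp g 2 (volume.restrict (Ioo a b)) := by
  obtain ⟨C, hC⟩ := isCompact_Icc.exists_bound_of_continuousOn (s := Icc a b) hg.continuousOn
  refine MemLp.of_bound hg.aestronglyMeasurable C ?_
  filter_upwards [ae_restrict_mem measurableSet_Ioo] with x hx
  exact hC x (Ioo_subset_Icc_self hx)

theorem memLp_of_airy_Ioo {a b : ℝ} {g : ℕ → ℝ → ℂ}
    (hg : ∀ j < 3, IsPrimitive (g j) (g (j + 1))) {α β : ℂ} (hα : α ≠ 0)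
    (hf : MemLp (fun x => α * g 3 x + β * g 1 x) 2 (volume.restrict (Ioo a b))) :
    ∀ j ≤ 3, MemLp (g j) 2 (volume.restrict (Ioo a b)) := by
  have hc (j : ℕ) (hj : j < 3) := memLp_Ioo_of_continuous (hg j hj).continuous a b
  intro j hj
  rcases hj.lt_or_eq with hj | rfl
  · exact hc j hj
  · convert (hf.sub ((hc 1 (by norm_num)).const_mul β)).const_mul α⁻¹ using 1
    funext x
    simp only [Pi.sub_apply]
    field_simp
    ring

/-! ### Representatives of `H³` functions and Green's formula on an edge -/

/-- The extension by zero to `ℝ` of an element of `L²(Ω)`. -/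
noncomputable def extend {Ω : Opens ℝ} (u : L2 Ω) : ℝ → ℂ := (Ω : Set ℝ).indicator u

theorem ae_eq_extend {Ω : Opens ℝ} (u : L2 Ω) :
    u =ᵐ[volume.restrict (Ω : Set ℝ)] extend u := by
  filter_upwards [ae_restrict_mem Ω.isOpen.measurableSet] with x hx
  exact (indicator_of_mem hx _).symm

theorem locallyIntegrable_extend {Ω : Opens ℝ} (u : L2 Ω) :
    LocallyIntegrable (extend u) volume :=
  ((memLp_indicator_iff_restrict Ω.isOpen.measurableSet).2 (Lp.memLp u)).locallyIntegrable
    (by norm_num)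

theorem setIntegral_mul_test {Ω : Opens ℝ} {u f : ℝ → ℂ} (hf : LocallyIntegrable f volume)
    (h : u =ᵐ[volume.restrict (Ω : Set ℝ)] f) (φ : 𝓓(Ω, ℂ)) :
    ∫ x in (Ω : Set ℝ), u x * φ x = pairing Ω f hf φ := by
  have e : ∫ x in (Ω : Set ℝ), u x * φ x = ∫ x in (Ω : Set ℝ), f x * φ x := by
    refine integral_congr_ae ?_
    filter_upwards [h] with x hx
    rw [hx]
  rw [e, pairing_apply]
  refine setIntegral_eq_integral_of_forall_compl_eq_zero fun x hx => ?_
  rw [image_eq_zero_of_notMem_tsupport fun hxs => hx (φ.tsupport_subset hxs), mul_zero]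

theorem coe_testDeriv_iterate {Ω : Opens ℝ} (j : ℕ) (φ : 𝓓(Ω, ℂ)) :
    ((testDeriv Ω)^[j] φ : ℝ → ℂ) = iteratedDeriv j φ := by
  induction j with
  | zero => simp
  | succ j ih => rw [Function.iterate_succ_apply', coe_testDeriv, ih, iteratedDeriv_succ]

/-- `g 0` is a representative of `u ∈ L²(Ω)` which witnesses `u ∈ H³(Ω)`: for `j < 3` the function
`g j` is absolutely continuous with derivative `g (j + 1)`, on all of `ℝ`, and `g 0, …, g 3` are
square integrable on `Ω`. The values `g j` with `3 < j` are irrelevant. -/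
structure IsSobolevRep {Ω : Opens ℝ} (u : L2 Ω) (g : ℕ → ℝ → ℂ) : Prop where
  isPrimitive : ∀ j < 3, IsPrimitive (g j) (g (j + 1))
  memLp : ∀ j ≤ 3, MemLp (g j) 2 (volume.restrict (Ω : Set ℝ))
  ae_eq : u =ᵐ[volume.restrict (Ω : Set ℝ)] g 0

namespace IsSobolevRep

variable {Ω : Opens ℝ} {u : L2 Ω} {g : ℕ → ℝ → ℂ}

theorem locallyIntegrable (h : IsSobolevRep u g) {j : ℕ} (hj : j ≤ 3) :
    LocallyIntegrable (g j) volume := by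
  rcases hj.lt_or_eq with hj | rfl
  · exact (h.isPrimitive j hj).continuous.locallyIntegrable
  · exact (h.isPrimitive 2 (by norm_num)).locallyIntegrable

theorem hasDerivAt (h : IsSobolevRep u g) {j : ℕ} (hj : j < 2) (x : ℝ) :
    HasDerivAt (g j) (g (j + 1) x) x :=
  (h.isPrimitive j (by omega)).hasDerivAt (h.isPrimitive (j + 1) (by omega)).continuous x

theorem iteratedDeriv_eq (h : IsSobolevRep u g) {j : ℕ} (hj : j ≤ 2) :
    iteratedDeriv j (g 0) = g j := by
  induction j with
  | zero => exact iteratedDeriv_zero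
  | succ j ih =>
    rw [iteratedDeriv_succ, ih (by omega)]
    exact funext fun x => (h.hasDerivAt (by omega) x).deriv

theorem contDiff (h : IsSobolevRep u g) : ContDiff ℝ 2 (g 0) := by
  refine (contDiff_nat_iff_iteratedDeriv (n := 2)).2 ⟨fun m hm => ?_, fun m hm => ?_⟩
  · rw [h.iteratedDeriv_eq (by exact_mod_cast hm)]
    exact (h.isPrimitive m (by have : m ≤ 2 := by exact_mod_cast hm
                               omega)).continuous
  · have hm' : m < 2 := by exact_mod_cast hm
    rw [h.iteratedDeriv_eq hm'.le]
    exact fun x => (h.hasDerivAt hm' x).differentiableAt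

theorem jet_eq (h : IsSobolevRep u g) {a : ℝ} (ha : a ∈ closure (Ω : Set ℝ)) :
    jet u a = fun j : Fin 3 => g j a := by
  rw [LoopingEdge.jet_eq h.contDiff h.ae_eq ha]
  funext j
  rw [h.iteratedDeriv_eq (by omega)]

theorem pairing_iterate (h : IsSobolevRep u g) {j : ℕ} (hj : j ≤ 3) (φ : 𝓓(Ω, ℂ)) :
    pairing Ω (g 0) (h.locallyIntegrable (by norm_num)) ((testDeriv Ω)^[j] φ) =
      (-1) ^ j * pairing Ω (g j) (h.locallyIntegrable hj) φ := by
  induction j generalizing φ with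
  | zero => simp
  | succ j ih =>
    rw [Function.iterate_succ_apply, ih (by omega),
      (h.isPrimitive j (by omega)).pairing_testDeriv, pow_succ]
    ring

theorem isWeakDeriv (h : IsSobolevRep u g) {j : ℕ} (hj : j ≤ 3) :
    IsWeakDeriv j u ((h.memLp j hj).toLp (g j)) := by
  intro φ
  rw [setIntegral_mul_test (h.locallyIntegrable hj) (h.memLp j hj).coeFn_toLp φ,
    ← h.pairing_iterate hj φ, ← coe_testDeriv_iterate,
    setIntegral_mul_test (h.locallyIntegrable (by norm_num)) h.ae_eq]

end IsSobolevRep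

section Edges

variable {k : ℕ} {L : ℝ}

theorem ordConnected_edgeSet (e : Edge k) : (edgeSet L e : Set ℝ).OrdConnected := by
  cases e
  · exact ordConnected_Ioo
  · exact ordConnected_Ioi

theorem nonempty_edgeSet (hL : 0 < L) (e : Edge k) : (edgeSet L e : Set ℝ).Nonempty := by
  cases e
  · exact nonempty_Ioo.2 (by linarith)
  · exact nonempty_Ioi

/-- Regularity up to the boundary: if `u, f ∈ L²` of an edge and `α u''' + β u' = f` in
the sense of distributions, then `u ∈ H³`. -/
theorem exists_isSobolevRep_of_weak_airy (hL : 0 < L) {e : Edge k} (u f : L2 (edgeSet L e))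
    {a b : ℂ} (ha : a ≠ 0)
    (h : ∀ φ : 𝓓(edgeSet L e, ℂ), a * pairing _ (extend u) (locallyIntegrable_extend u)
        (testDeriv _ (testDeriv _ (testDeriv _ φ))) +
      b * pairing _ (extend u) (locallyIntegrable_extend u) (testDeriv _ φ) =
        -pairing _ (extend f) (locallyIntegrable_extend f) φ) :
    ∃ g, IsSobolevRep u g ∧
      f =ᵐ[volume.restrict (edgeSet L e : Set ℝ)] fun x => a * g 3 x + b * g 1 x := by
  obtain ⟨g, hg, hug, hfg⟩ := exists_primitives_of_weak_airy (ordConnected_edgeSet e)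
    (nonempty_edgeSet hL e) (locallyIntegrable_extend u) (locallyIntegrable_extend f) ha h
  have hu := (ae_eq_extend u).trans hug
  have hf : f =ᵐ[volume.restrict (edgeSet L e : Set ℝ)] fun x => a * g 3 x + b * g 1 x := by
    filter_upwards [ae_eq_extend f, ae_restrict_mem (edgeSet L e).isOpen.measurableSet] with x hx hm
    rw [hx, hfg x hm]
  refine ⟨g, ⟨hg, ?_, hu⟩, hf⟩
  cases e with
  | none => exact memLp_of_airy_Ioo hg ha ((memLp_congr_ae hf).1 (Lp.memLp f))
  | some e =>
    exact memLp_of_airy_Ioi hg ha ((memLp_congr_ae hu).1 (Lp.memLp u))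
      ((memLp_congr_ae hf).1 (Lp.memLp f))

theorem mem_sobolevSpace_iff (hL : 0 < L) {e : Edge k} (u : L2 (edgeSet L e)) :
    u ∈ sobolevSpace 3 (edgeSet L e) ↔ ∃ g, IsSobolevRep u g := by
  constructor
  · intro hu
    obtain ⟨v, hv⟩ := hu 3 le_rfl
    obtain ⟨g, hg, -⟩ := exists_isSobolevRep_of_weak_airy hL u v (a := 1) (b := 0) one_ne_zero
      fun φ => by
        have := hv φ
        rw [← coe_testDeriv_iterate, setIntegral_mul_test (locallyIntegrable_extend u)
          (ae_eq_extend u), setIntegral_mul_test (locallyIntegrable_extend v) (ae_eq_extend v)]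
          at this
        simp only [Function.iterate_succ_apply, Function.iterate_zero_apply] at this
        rw [this]
        ring
    exact ⟨g, hg⟩
  · rintro ⟨g, hg⟩ j hj
    exact ⟨_, hg.isWeakDeriv hj⟩

/-- The boundary term of a function `Q` on an edge: its value at the right end point
(zero for a half-line) minus its value at the left one. -/
def edgeJump (L : ℝ) (e : Edge k) (Q : ℝ → ℂ) : ℂ :=
  match e with
  | none => Q L - Q (-L)
  | some _ => -Q L

theorem integral_eq_edgeJump (hL : 0 < L) {e : Edge k} {Q q : ℝ → ℂ} (h : IsPrimitive Q q)
    (hQ : IntegrableOn Q (edgeSet L e)) (hq : IntegrableOn q (edgeSet L e)) :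
    ∫ x in (edgeSet L e : Set ℝ), q x = edgeJump L e Q := by
  cases e with
  | none =>
    change ∫ x in Ioo (-L) L, q x = Q L - Q (-L)
    rw [h.sub_eq, intervalIntegral.integral_of_le (by linarith), integral_Ioc_eq_integral_Ioo]
  | some e =>
    change ∫ x in Ioi L, q x = -Q L
    have h₁ := intervalIntegral_tendsto_integral_Ioi L hq tendsto_id
    have h₂ : Tendsto Q atTop (𝓝 (Q L + ∫ x in Ioi L, q x)) := by
      refine (h₁.const_add (Q L)).congr fun x => ?_
      exact (h.eq_add L x).symm
    have h₃ : Q L + ∫ x in Ioi L, q x = 0 := by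
      refine IntegrableAtFilter.eq_zero_of_tendsto ⟨Ioi L, Ioi_mem_atTop L, hQ⟩ ?_ h₂
      intro s hs
      obtain ⟨c, hc⟩ := mem_atTop_sets.1 hs
      refine top_unique ?_
      rw [← Real.volume_Ici (a := c)]
      exact measure_mono hc
    exact eq_neg_of_add_eq_zero_right h₃

/-- The boundary form of `α ∂³ + β ∂`, evaluated at `x`; it is sesquilinear in the two jets. -/
def concomitant (a b : ℝ) (g h : ℕ → ℝ → ℂ) (x : ℝ) : ℂ :=
  (edgeMatrix a b *ᵥ fun j : Fin 3 => g j x) ⬝ᵥ star fun j : Fin 3 => h j x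

theorem concomitant_eq (a b : ℝ) (g h : ℕ → ℝ → ℂ) (x : ℝ) :
    concomitant a b g h x = b * (g 0 x * star (h 0 x)) + a * (g 2 x * star (h 0 x)) +
      -a * (g 1 x * star (h 1 x)) + a * (g 0 x * star (h 2 x)) := by
  simp [concomitant, edgeMatrix, dotProduct, Matrix.mulVec, Fin.sum_univ_three]
  ring

/-- Green's formula on one edge. -/
theorem integral_airy_add_airy (hL : 0 < L) {e : Edge k} {u v : L2 (edgeSet L e)}
    {g h : ℕ → ℝ → ℂ} (hg : IsSobolevRep u g) (hh : IsSobolevRep v h) (a b : ℝ) :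
    ∫ x in (edgeSet L e : Set ℝ), ((a * g 3 x + b * g 1 x) * star (h 0 x) +
      g 0 x * star (a * h 3 x + b * h 1 x)) = edgeJump L e (concomitant a b g h) := by
  have hp (i j : ℕ) (hi : i < 3) (hj : j < 3) :=
    (hg.isPrimitive i hi).mul (hh.isPrimitive j hj).conj
  have hI (i j : ℕ) (hi : i ≤ 3) (hj : j ≤ 3) :
      IntegrableOn (fun x => g i x * star (h j x)) (edgeSet L e) :=
    (hg.memLp i hi).integrable_mul (hh.memLp j hj).star
  have hP := ((((hp 0 0 (by norm_num) (by norm_num)).const_mul b).add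
    ((hp 2 0 (by norm_num) (by norm_num)).const_mul a)).add
    ((hp 1 1 (by norm_num) (by norm_num)).const_mul (-a))).add
    ((hp 0 2 (by norm_num) (by norm_num)).const_mul a)
  have hQ : IntegrableOn (concomitant a b g h) (edgeSet L e) := by
    have := ((((hI 0 0 (by norm_num) (by norm_num)).const_mul (b : ℂ)).add
      ((hI 2 0 (by norm_num) (by norm_num)).const_mul (a : ℂ))).add
      ((hI 1 1 (by norm_num) (by norm_num)).const_mul (-a : ℂ))).add
      ((hI 0 2 (by norm_num) (by norm_num)).const_mul (a : ℂ))
    exact this.congr (ae_of_all _ fun x => (concomitant_eq a b g h x).symm)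
  have hq : IntegrableOn (fun x => (a * g 3 x + b * g 1 x) * star (h 0 x) +
      g 0 x * star (a * h 3 x + b * h 1 x)) (edgeSet L e) := by
    have := ((((hI 3 0 (by norm_num) (by norm_num)).const_mul (a : ℂ)).add
      ((hI 1 0 (by norm_num) (by norm_num)).const_mul (b : ℂ))).add
      ((hI 0 3 (by norm_num) (by norm_num)).const_mul (a : ℂ))).add
      ((hI 0 1 (by norm_num) (by norm_num)).const_mul (b : ℂ))
    refine this.congr (ae_of_all _ fun x => ?_)
    simp
    ring
  refine integral_eq_edgeJump hL ?_ hQ hq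
  convert hP using 1
  · exact funext fun x => concomitant_eq a b g h x
  · funext x
    simp
    ring

end Edges

/-! ### The maximal operator and the trace map -/

section Adjoint

variable {H : Type*} [NormedAddCommGroup H] [InnerProductSpace ℂ H] [CompleteSpace H]

theorem mem_graph_neg_adjoint_iff {T : H →ₗ.[ℂ] H} (hT : Dense (T.domain : Set H)) (x : H × H) :
    x ∈ (-T.adjoint).graph ↔ ∀ a b, (a, b) ∈ T.graph → inner ℂ b x.1 + inner ℂ a x.2 = 0 := by
  have h : x ∈ (-T.adjoint).graph ↔ (x.1, -x.2) ∈ T.adjoint.graph := by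
    simp only [LinearPMap.mem_graph_iff, LinearPMap.neg_domain, LinearPMap.neg_apply]
    constructor
    · rintro ⟨y, h₁, h₂⟩
      exact ⟨y, h₁, by rw [← h₂, neg_neg]⟩
    · rintro ⟨y, h₁, h₂⟩
      exact ⟨y, h₁, by rw [h₂, neg_neg]⟩
  rw [h, LinearPMap.adjoint_graph_eq_graph_adjoint hT, Submodule.mem_adjoint_iff]
  simp only [inner_neg_right, sub_neg_eq_add]

theorem isSkewSelfAdjoint_iff_graph {A : H →ₗ.[ℂ] H} (hA : Dense (A.domain : Set H)) :
    IsSkewSelfAdjoint A ↔ (-A.adjoint).graph = A.graph := by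
  constructor
  · rintro ⟨-, h⟩
    rw [h, neg_neg]
  · intro h
    refine ⟨hA, ?_⟩
    rw [← neg_neg A.adjoint, LinearPMap.eq_of_eq_graph h]

end Adjoint

section TestVectors

variable {Ω : Opens ℝ}

/-- The class in `L²(Ω)` of a test function. -/
noncomputable def testL2 (φ : 𝓓(Ω, ℂ)) : L2 Ω :=
  MemLp.toLp φ (φ.continuous.memLp_of_hasCompactSupport φ.hasCompactSupport)

theorem coeFn_testL2 (φ : 𝓓(Ω, ℂ)) : testL2 φ =ᵐ[volume.restrict (Ω : Set ℝ)] φ :=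
  MemLp.coeFn_toLp _

theorem testL2_zero : testL2 (0 : 𝓓(Ω, ℂ)) = 0 := MemLp.toLp_zero _

/-- The complex conjugate of a test function. -/
noncomputable def testConj (φ : 𝓓(Ω, ℂ)) : 𝓓(Ω, ℂ) where
  toFun x := star (φ x)
  contDiff' := Complex.conjCLE.contDiff.comp φ.contDiff
  hasCompactSupport' := φ.hasCompactSupport.comp_left (g := fun z : ℂ => star z) (star_zero ℂ)
  tsupport_subset' :=
    (tsupport_comp_subset (g := fun z : ℂ => star z) (star_zero ℂ) φ).trans φ.tsupport_subset

theorem testConj_testConj (φ : 𝓓(Ω, ℂ)) : testConj (testConj φ) = φ := by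
  ext x
  exact star_star _

theorem testDeriv_testConj (φ : 𝓓(Ω, ℂ)) :
    testDeriv Ω (testConj φ) = testConj (testDeriv Ω φ) := by
  ext x
  exact deriv.star

theorem inner_testL2_testConj (φ : 𝓓(Ω, ℂ)) (w : L2 Ω) :
    inner ℂ (testL2 (testConj φ)) w = pairing Ω (extend w) (locallyIntegrable_extend w) φ := by
  rw [L2.inner_def, ← setIntegral_mul_test _ (ae_eq_extend w)]
  refine integral_congr_ae ?_
  filter_upwards [coeFn_testL2 (testConj φ)] with x hx
  rw [hx, RCLike.inner_apply]
  congr 1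
  exact star_star _

/-- The Airy operator `α ∂³ + β ∂` on test functions. -/
noncomputable def testAiry (Ω : Opens ℝ) (a b : ℝ) : 𝓓(Ω, ℂ) →ₗ[ℂ] 𝓓(Ω, ℂ) :=
  (a : ℂ) • (testDeriv Ω ∘ₗ testDeriv Ω ∘ₗ testDeriv Ω) + (b : ℂ) • testDeriv Ω

theorem testAiry_apply (a b : ℝ) (φ : 𝓓(Ω, ℂ)) (x : ℝ) :
    testAiry Ω a b φ x = a * iteratedDeriv 3 φ x + b * deriv φ x := by
  rw [← coe_testDeriv_iterate 3 φ]
  rfl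

theorem testAiry_testConj (a b : ℝ) (φ : 𝓓(Ω, ℂ)) :
    testAiry Ω a b (testConj φ) = testConj (testAiry Ω a b φ) := by
  ext x
  have h₁ : testAiry Ω a b (testConj φ) x =
      a * testDeriv Ω (testDeriv Ω (testDeriv Ω (testConj φ))) x +
        b * testDeriv Ω (testConj φ) x := rfl
  have h₂ : testConj (testAiry Ω a b φ) x =
      star (a * testDeriv Ω (testDeriv Ω (testDeriv Ω φ)) x + b * testDeriv Ω φ x) := rfl
  have h₃ (ψ : 𝓓(Ω, ℂ)) : testConj ψ x = star (ψ x) := rfl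
  rw [h₁, h₂, testDeriv_testConj, testDeriv_testConj, testDeriv_testConj, h₃, h₃]
  simp

end TestVectors

section Graph

variable {k : ℕ} {L : ℝ} {α β : Edge k → ℝ}

/-- The element of `L²(𝒢)` given by a family of test functions. -/
noncomputable def testVec (φ : (e : Edge k) → 𝓓(edgeSet L e, ℂ)) : L2G k L :=
  WithLp.toLp 2 fun e => testL2 (φ e)

theorem mem_airyGraph_iff (p : L2G k L × L2G k L) :
    p ∈ airyGraph L α β ↔ ∃ φ : (e : Edge k) → 𝓓(edgeSet L e, ℂ),
      p = (testVec φ, testVec fun e => testAiry _ (α e) (β e) (φ e)) := by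
  constructor
  · rintro ⟨φ, hφ⟩
    refine ⟨φ, Prod.ext ?_ ?_⟩
    · ext1 e
      exact Lp.ext ((hφ e).1.trans (coeFn_testL2 _).symm)
    · ext1 e
      refine Lp.ext ((hφ e).2.trans (EventuallyEq.trans ?_ (coeFn_testL2 _).symm))
      exact ae_of_all _ fun x => (testAiry_apply _ _ _ x).symm
  · rintro ⟨φ, rfl⟩
    refine ⟨φ, fun e => ⟨coeFn_testL2 _, (coeFn_testL2 _).trans ?_⟩⟩
    exact ae_of_all _ fun x => testAiry_apply _ _ _ x

open Classical in
/-- A test function on one edge, extended by zero to the other edges. -/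
noncomputable def singleTest (e : Edge k) (φ : 𝓓(edgeSet L e, ℂ)) :
    (e : Edge k) → 𝓓(edgeSet L e, ℂ) := Pi.single e φ

theorem inner_testVec_singleTest (T : (e : Edge k) → 𝓓(edgeSet L e, ℂ) →ₗ[ℂ] 𝓓(edgeSet L e, ℂ))
    (e : Edge k) (φ : 𝓓(edgeSet L e, ℂ)) (W : L2G k L) :
    inner ℂ (testVec fun e' => T e' (singleTest e φ e')) W =
      inner ℂ (testL2 (T e φ)) (W e) := by
  rw [PiLp.inner_apply, Finset.sum_eq_single e]
  · change inner ℂ (testL2 (T e (singleTest e φ e))) (W e) = _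
    rw [singleTest, Pi.single_eq_same]
  · intro e' _ hne
    change inner ℂ (testL2 (T e' (singleTest e φ e'))) (W e') = _
    rw [singleTest, Pi.single_eq_of_ne hne, map_zero, testL2_zero, inner_zero_left]
  · simp

theorem dense_airy_domain : Dense ((airy L α β).domain : Set (L2G k L)) := by
  rw [Submodule.dense_iff_topologicalClosure_eq_top, Submodule.topologicalClosure_eq_top_iff,
    Submodule.eq_bot_iff]
  intro W hW
  rw [Submodule.mem_orthogonal] at hW
  ext1 e
  refine Lp.ext ((ae_eq_extend _).trans (EventuallyEq.trans ?_ (Lp.coeFn_zero ℂ 2 _).symm))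
  refine ae_eq_of_pairing_eq (locallyIntegrable_extend _) locallyIntegrable_zero
    (LinearMap.ext fun φ => ?_)
  have hz : pairing (edgeSet L e) (0 : ℝ → ℂ) locallyIntegrable_zero φ = 0 := by
    simp [pairing_apply]
  rw [hz, ← inner_testL2_testConj]
  have hmem : (testVec (singleTest e (testConj φ)), testVec fun e' =>
      testAiry _ (α e') (β e') (singleTest e (testConj φ) e')) ∈ (airy L α β).graph := by
    rw [airy_graph, mem_airyGraph_iff]
    exact ⟨_, rfl⟩
  have := hW _ (LinearPMap.mem_domain_of_mem_graph hmem)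
  rwa [show testVec (singleTest e (testConj φ)) = testVec fun e' =>
    (LinearMap.id : 𝓓(edgeSet L e', ℂ) →ₗ[ℂ] 𝓓(edgeSet L e', ℂ)) (singleTest e (testConj φ) e')
    from rfl, inner_testVec_singleTest (fun _ => LinearMap.id)] at this

/-- The maximal Airy operator `-A₀*` is the differential expression of `A₀` on `H³(𝒢)`. -/
theorem mem_graph_maximal_iff (hL : 0 < L) (hα : ∀ e, α e ≠ 0) (p : L2G k L × L2G k L) :
    p ∈ (-(airy L α β).adjoint).graph ↔ ∀ e, ∃ g, IsSobolevRep (p.1 e) g ∧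
      p.2 e =ᵐ[volume.restrict (edgeSet L e : Set ℝ)]
        fun x => (α e : ℂ) * g 3 x + (β e : ℂ) * g 1 x := by
  rw [mem_graph_neg_adjoint_iff dense_airy_domain, airy_graph]
  have hweak (e : Edge k) (φ : 𝓓(edgeSet L e, ℂ)) :
      inner ℂ (testL2 (testAiry _ (α e) (β e) (testConj φ))) (p.1 e) =
        α e * pairing _ (extend (p.1 e)) (locallyIntegrable_extend _)
          (testDeriv _ (testDeriv _ (testDeriv _ φ))) +
        β e * pairing _ (extend (p.1 e)) (locallyIntegrable_extend _) (testDeriv _ φ) := by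
    rw [testAiry_testConj, inner_testL2_testConj, testAiry]
    simp only [LinearMap.add_apply, LinearMap.smul_apply, LinearMap.comp_apply, map_add, map_smul,
      smul_eq_mul]
  constructor
  · intro h e
    refine exists_isSobolevRep_of_weak_airy hL (p.1 e) (p.2 e)
      (by exact_mod_cast hα e : (α e : ℂ) ≠ 0) fun φ => ?_
    have := h _ _ ((mem_airyGraph_iff _).2 ⟨singleTest e (testConj φ), rfl⟩)
    rw [inner_testVec_singleTest (fun e' => testAiry _ (α e') (β e')),
      show testVec (singleTest e (testConj φ)) = testVec fun e' =>
      (LinearMap.id : 𝓓(edgeSet L e', ℂ) →ₗ[ℂ] 𝓓(edgeSet L e', ℂ)) (singleTest e (testConj φ) e')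
      from rfl, inner_testVec_singleTest (fun _ => LinearMap.id), LinearMap.id_apply,
      hweak, inner_testL2_testConj] at this
    exact eq_neg_of_add_eq_zero_left this
  · intro h a b hab
    obtain ⟨φ, hφ⟩ := (mem_airyGraph_iff _).1 hab
    obtain ⟨rfl, rfl⟩ := Prod.mk.inj hφ
    rw [PiLp.inner_apply, PiLp.inner_apply, ← Finset.sum_add_distrib]
    refine Finset.sum_eq_zero fun e _ => ?_
    obtain ⟨g, hg, hV⟩ := h e
    change inner ℂ (testL2 (testAiry _ (α e) (β e) (φ e))) (p.1 e) +
      inner ℂ (testL2 (φ e)) (p.2 e) = 0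
    rw [← testConj_testConj (φ e), hweak, inner_testL2_testConj]
    set ψ := testConj (φ e)
    have hl₃ := (hg.locallyIntegrable (j := 3) le_rfl)
    have hl₁ := (hg.locallyIntegrable (j := 1) (by norm_num))
    have hu (χ : 𝓓(edgeSet L e, ℂ)) :
        pairing _ (extend (p.1 e)) (locallyIntegrable_extend _) χ =
          pairing _ (g 0) (hg.locallyIntegrable (by norm_num)) χ := by
      rw [← setIntegral_mul_test _ (ae_eq_extend _), setIntegral_mul_test _ hg.ae_eq]
    have hv : pairing _ (extend (p.2 e)) (locallyIntegrable_extend _) ψ =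
        α e * pairing _ (g 3) hl₃ ψ + β e * pairing _ (g 1) hl₁ ψ := by
      have hl : LocallyIntegrable (fun x => (α e : ℂ) * g 3 x + (β e : ℂ) * g 1 x) volume :=
        (hl₃.smul (α e : ℂ)).add (hl₁.smul (β e : ℂ))
      rw [← setIntegral_mul_test _ (ae_eq_extend _), setIntegral_mul_test hl hV]
      simp only [pairing_apply]
      rw [← integral_const_mul, ← integral_const_mul, ← integral_add
        ((integrable_mul_test hl₃ ψ).const_mul _) ((integrable_mul_test hl₁ ψ).const_mul _)]
      exact integral_congr_ae (ae_of_all _ fun x => by ring)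
    have h₃ := hg.pairing_iterate (j := 3) le_rfl ψ
    have h₁ := hg.pairing_iterate (j := 1) (by norm_num) ψ
    simp only [Function.iterate_succ_apply, Function.iterate_zero_apply] at h₃ h₁
    rw [hu, hu, hv, h₃, h₁]
    ring

theorem adjoint_domain_eq (hL : 0 < L) (hα : ∀ e, α e ≠ 0) :
    ((airy L α β).adjoint.domain : Set (L2G k L)) = sobolevSpaceG 3 k L := by
  ext U
  constructor
  · intro hU e
    have hU' : U ∈ (-(airy L α β).adjoint).domain := hU
    have hmem := LinearPMap.mem_graph (-(airy L α β).adjoint) ⟨U, hU'⟩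
    obtain ⟨g, hg, -⟩ := (mem_graph_maximal_iff hL hα _).1 hmem e
    exact (mem_sobolevSpace_iff hL _).2 ⟨g, hg⟩
  · intro hU
    choose g hg using fun e => (mem_sobolevSpace_iff hL _).1 (hU e)
    have hm (e : Edge k) : MemLp (fun x => (α e : ℂ) * g e 3 x + (β e : ℂ) * g e 1 x) 2
        (volume.restrict (edgeSet L e : Set ℝ)) :=
      (((hg e).memLp 3 le_rfl).const_mul _).add (((hg e).memLp 1 (by norm_num)).const_mul _)
    have : (U, (WithLp.toLp 2 fun e => (hm e).toLp _ : L2G k L)) ∈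
        (-(airy L α β).adjoint).graph :=
      (mem_graph_maximal_iff hL hα _).2 fun e => ⟨g e, hg e, (hm e).coeFn_toLp⟩
    have hd : U ∈ (-(airy L α β).adjoint).domain := LinearPMap.mem_domain_of_mem_graph this
    exact hd

theorem blockDiagonal_mulVec_dotProduct {ι : Type*} [Fintype ι] [DecidableEq ι]
    (M : ι → Matrix (Fin 3) (Fin 3) ℂ) (x y : Fin 3 × ι → ℂ) :
    (Matrix.blockDiagonal M *ᵥ x) ⬝ᵥ y =
      ∑ i, (M i *ᵥ fun j => x (j, i)) ⬝ᵥ fun j => y (j, i) := by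
  simp [dotProduct, Matrix.mulVec, Fintype.sum_prod_type_right, Matrix.blockDiagonal_apply]

theorem mem_closure_edgeSet (hL : 0 < L) (e : Edge k) :
    L ∈ closure (edgeSet L e : Set ℝ) := by
  cases e with
  | none =>
    change L ∈ closure (Ioo (-L) L)
    rw [closure_Ioo (by linarith)]
    exact ⟨by linarith, le_rfl⟩
  | some e =>
    change L ∈ closure (Ioi L)
    rw [closure_Ioi]
    exact self_mem_Ici

theorem neg_mem_closure_edgeSet_none (hL : 0 < L) :
    -L ∈ closure (edgeSet L (none : Edge k) : Set ℝ) := by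
  change -L ∈ closure (Ioo (-L) L)
  rw [closure_Ioo (by linarith)]
  exact ⟨le_rfl, by linarith⟩

/-- The boundary terms of all edges add up to the boundary form of the traces. -/
theorem bform_trace (hL : 0 < L) {U V : L2G k L} {g h : Edge k → ℕ → ℝ → ℂ}
    (hg : ∀ e, IsSobolevRep (U e) (g e)) (hh : ∀ e, IsSobolevRep (V e) (h e)) :
    bform α β (tracePlus U, traceMinus U) (tracePlus V, traceMinus V) =
      -∑ e, edgeJump L e (concomitant (α e) (β e) (g e) (h e)) := by
  have hU (e : Edge k) := (hg e).jet_eq (mem_closure_edgeSet hL e)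
  have hV (e : Edge k) := (hh e).jet_eq (mem_closure_edgeSet hL e)
  have hU' := (hg none).jet_eq (neg_mem_closure_edgeSet_none hL)
  have hV' := (hh none).jet_eq (neg_mem_closure_edgeSet_none hL)
  have hs (y : BVec k) (i : Option (Fin k)) :
      (fun j => star y (j, i)) = star fun j : Fin 3 => y (j, i) := rfl
  simp only [bform, matPlus, matMinus, blockDiagonal_mulVec_dotProduct, Fintype.sum_option,
    Fintype.sum_sum_type, hs, tracePlus, traceMinus, hU, hV, hU', hV', edgeJump, concomitant,
    Matrix.neg_mulVec, neg_dotProduct, Finset.sum_neg_distrib]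
  ring

/-- Green's formula: the symmetric part of the maximal operator is, up to sign, the boundary form
of the traces. -/
theorem inner_add_inner_eq (hL : 0 < L) (hα : ∀ e, α e ≠ 0) {p q : L2G k L × L2G k L}
    (hp : p ∈ (-(airy L α β).adjoint).graph) (hq : q ∈ (-(airy L α β).adjoint).graph) :
    inner ℂ q.2 p.1 + inner ℂ q.1 p.2 =
      -bform α β (tracePlus p.1, traceMinus p.1) (tracePlus q.1, traceMinus q.1) := by
  choose g hg hpg using (mem_graph_maximal_iff hL hα p).1 hp
  choose h hh hqh using (mem_graph_maximal_iff hL hα q).1 hq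
  rw [bform_trace hL hg hh, neg_neg, PiLp.inner_apply, PiLp.inner_apply, ← Finset.sum_add_distrib]
  refine Finset.sum_congr rfl fun e _ => ?_
  rw [← integral_airy_add_airy hL (hg e) (hh e), L2.inner_def, L2.inner_def,
    ← integral_add (L2.integrable_inner _ _) (L2.integrable_inner _ _)]
  refine integral_congr_ae ?_
  filter_upwards [(hg e).ae_eq, hpg e, (hh e).ae_eq, hqh e] with x h₁ h₂ h₃ h₄
  rw [h₁, h₂, h₃, h₄, RCLike.inner_apply, RCLike.inner_apply, add_comm]
  rfl

end Graph

section Traces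

/-- The quadratic polynomial with prescribed jet at `c`, cut off by a bump function around `c`. -/
theorem exists_contDiff_jet {c r R : ℝ} (hr : 0 < r) (hrR : r < R) (v : Fin 3 → ℂ) :
    ∃ f : ℝ → ℂ, ContDiff ℝ (⊤ : ℕ∞) f ∧ tsupport f ⊆ Icc (c - R) (c + R) ∧
      ∀ j : Fin 3, iteratedDeriv j f c = v j := by
  let b : ContDiffBump c := ⟨r, R, hr, hrR⟩
  let P₂ : ℝ → ℂ := fun _ => v 2
  let P₁ : ℝ → ℂ := fun x => v 1 + v 2 * ((x - c : ℝ) : ℂ)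
  let P : ℝ → ℂ := fun x => v 0 + v 1 * ((x - c : ℝ) : ℂ) + v 2 / 2 * ((x - c : ℝ) : ℂ) ^ 2
  have hx (x : ℝ) : HasDerivAt (fun x : ℝ => ((x - c : ℝ) : ℂ)) 1 x := by
    have := ((hasDerivAt_id x).sub_const c).ofReal_comp
    simpa using this
  have hP (x : ℝ) : HasDerivAt P (P₁ x) x := by
    have := (((hx x).const_mul (v 1)).const_add (v 0)).add (((hx x).pow 2).const_mul (v 2 / 2))
    convert! this using 1
    simp only [P₁]
    push_cast
    ring
  have hP₁ (x : ℝ) : HasDerivAt P₁ (P₂ x) x := by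
    have := ((hx x).const_mul (v 2)).const_add (v 1)
    rwa [mul_one] at this
  have hPs : ContDiff ℝ (⊤ : ℕ∞) P := by
    have : ContDiff ℝ (⊤ : ℕ∞) fun x : ℝ => ((x - c : ℝ) : ℂ) :=
      Complex.ofRealCLM.contDiff.comp (contDiff_id.sub contDiff_const)
    exact (contDiff_const.add (contDiff_const.mul this)).add (contDiff_const.mul (this.pow 2))
  have hPd : deriv P = P₁ := funext fun x => (hP x).deriv
  have hPd₁ : deriv P₁ = P₂ := funext fun x => (hP₁ x).deriv
  have hbs : ContDiff ℝ (⊤ : ℕ∞) fun x => ((b x : ℝ) : ℂ) :=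
    Complex.ofRealCLM.contDiff.comp b.contDiff
  refine ⟨fun x => P x * ((b x : ℝ) : ℂ), hPs.mul hbs, ?_, fun j => ?_⟩
  · rw [← Real.closedBall_eq_Icc]
    refine (tsupport_mul_subset_right (f := P)).trans ?_
    refine (tsupport_comp_subset (g := fun r : ℝ => (r : ℂ)) Complex.ofReal_zero _).trans ?_
    exact b.tsupport_eq.subset
  · have hev : (fun x => P x * ((b x : ℝ) : ℂ)) =ᶠ[𝓝 c] P := by
      filter_upwards [b.eventuallyEq_one] with x hx
      simp [hx]
    rw [hev.iteratedDeriv_eq]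
    fin_cases j
    · simp [P]
    · simp [hPd, P₁]
    · simp [iteratedDeriv_succ, hPd, hPd₁, P₂]

/-- The jets at `-L` and at `L` of a smooth compactly supported function are arbitrary. -/
theorem exists_contDiff_jets {L : ℝ} (hL : 0 < L) (v w : Fin 3 → ℂ) :
    ∃ f : ℝ → ℂ, ContDiff ℝ (⊤ : ℕ∞) f ∧ HasCompactSupport f ∧
      (∀ j : Fin 3, iteratedDeriv j f (-L) = v j) ∧ ∀ j : Fin 3, iteratedDeriv j f L = w j := by
  obtain ⟨f₁, h₁, s₁, j₁⟩ := exists_contDiff_jet (c := -L) (half_pos hL) (half_lt_self hL) v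
  obtain ⟨f₂, h₂, s₂, j₂⟩ := exists_contDiff_jet (c := L) (half_pos hL) (half_lt_self hL) w
  have hf₁ : f₁ =ᶠ[𝓝 L] 0 := notMem_tsupport_iff_eventuallyEq.1 fun h => by
    have := (s₁ h).2
    linarith
  have hf₂ : f₂ =ᶠ[𝓝 (-L)] 0 := notMem_tsupport_iff_eventuallyEq.1 fun h => by
    have := (s₂ h).1
    linarith
  refine ⟨f₁ + f₂, h₁.add h₂, ?_, fun j => ?_, fun j => ?_⟩
  · exact (HasCompactSupport.of_support_subset_isCompact isCompact_Icc
      (subset_closure.trans s₁)).add (HasCompactSupport.of_support_subset_isCompact isCompact_Icc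
      (subset_closure.trans s₂))
  · have : f₁ + f₂ =ᶠ[𝓝 (-L)] f₁ := by
      filter_upwards [hf₂] with x hx
      simp [hx]
    rw [this.iteratedDeriv_eq, j₁]
  · have : f₁ + f₂ =ᶠ[𝓝 L] f₂ := by
      filter_upwards [hf₁] with x hx
      simp [hx]
    rw [this.iteratedDeriv_eq, j₂]

theorem exists_isSobolevRep_of_contDiff {f : ℝ → ℂ} (hf : ContDiff ℝ (⊤ : ℕ∞) f)
    (hc : HasCompactSupport f) (Ω : Opens ℝ) :
    ∃ u : L2 Ω, IsSobolevRep u fun j => iteratedDeriv j f := by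
  have hcont (j : ℕ) : Continuous (iteratedDeriv j f) :=
    hf.continuous_iteratedDeriv j (by exact_mod_cast le_top)
  have hcs (j : ℕ) : HasCompactSupport (iteratedDeriv j f) := by
    induction j with
    | zero => simpa using hc
    | succ j ih => rw [iteratedDeriv_succ]; exact ih.deriv
  have hm (j : ℕ) : MemLp (iteratedDeriv j f) 2 (volume.restrict (Ω : Set ℝ)) :=
    (hcont j).memLp_of_hasCompactSupport (hcs j)
  refine ⟨(hm 0).toLp _, ⟨fun j _ => ?_, fun j _ => hm j, (hm 0).coeFn_toLp⟩⟩
  refine IsPrimitive.of_hasDerivAt (fun x => ?_) (hcont (j + 1))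
  rw [iteratedDeriv_succ]
  exact ((hf.differentiable_iteratedDeriv j (by exact_mod_cast ENat.natCast_lt_top j)) x).hasDerivAt

variable {k : ℕ} {L : ℝ} {α β : Edge k → ℝ}

theorem exists_trace_eq (hL : 0 < L) (x : BVec k × BVec k) :
    ∃ U ∈ sobolevSpaceG 3 k L, (tracePlus U, traceMinus U) = x := by
  choose f hf hc hv hw using fun e : Edge k => exists_contDiff_jets hL (fun j => x.1 (j, none))
    (match e with
      | none => fun j => x.2 (j, none)
      | some (Sum.inl i) => fun j => x.1 (j, some i)
      | some (Sum.inr i) => fun j => x.2 (j, some i))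
  choose u hu using fun e : Edge k => exists_isSobolevRep_of_contDiff (hf e) (hc e) (edgeSet L e)
  refine ⟨WithLp.toLp 2 u, fun e => (mem_sobolevSpace_iff hL _).2 ⟨_, hu e⟩, Prod.ext ?_ ?_⟩
  · funext ⟨j, i⟩
    cases i with
    | none =>
      change jet (u none) (-L) j = _
      rw [(hu none).jet_eq (neg_mem_closure_edgeSet_none hL)]
      exact hv none j
    | some i =>
      change jet (u (some (Sum.inl i))) L j = _
      rw [(hu _).jet_eq (mem_closure_edgeSet hL _)]
      exact hw (some (Sum.inl i)) j
  · funext ⟨j, i⟩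
    cases i with
    | none =>
      change jet (u none) L j = _
      rw [(hu none).jet_eq (mem_closure_edgeSet hL _)]
      exact hw none j
    | some i =>
      change jet (u (some (Sum.inr i))) L j = _
      rw [(hu _).jet_eq (mem_closure_edgeSet hL _)]
      exact hw (some (Sum.inr i)) j

theorem exists_mem_graph_trace_eq (hL : 0 < L) (hα : ∀ e, α e ≠ 0) (x : BVec k × BVec k) :
    ∃ p ∈ (-(airy L α β).adjoint).graph, (tracePlus p.1, traceMinus p.1) = x := by
  obtain ⟨U, hU, hx⟩ := exists_trace_eq hL x
  rw [← adjoint_domain_eq (α := α) (β := β) hL hα] at hU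
  have hU' : U ∈ (-(airy L α β).adjoint).domain := hU
  exact ⟨_, LinearPMap.mem_graph _ ⟨U, hU'⟩, hx⟩

theorem isSelfOrthogonal_iff (hL : 0 < L) (X : Submodule ℂ (BVec k × BVec k)) :
    IsSelfOrthogonal L α β X ↔ ∀ p, p ∈ X ↔ ∀ q ∈ X, bform α β p q = 0 := by
  have h (p : BVec k × BVec k) : p ∈ boundaryPlus k L ×ˢ boundaryMinus k L := by
    obtain ⟨U, hU, rfl⟩ := exists_trace_eq hL p
    exact ⟨⟨U, hU, rfl⟩, ⟨U, hU, rfl⟩⟩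
  rw [IsSelfOrthogonal, Set.ext_iff]
  refine forall_congr' fun p => ?_
  simp only [SetLike.mem_coe, mem_ofPred_eq, h p, true_and]

/-- The space of boundary values that are `w`-orthogonal to a given set. -/
def orthogonalTo (α β : Edge k → ℝ) (S : Set (BVec k × BVec k)) :
    Submodule ℂ (BVec k × BVec k) where
  carrier := {p | ∀ q ∈ S, bform α β p q = 0}
  zero_mem' q _ := by simp [bform]
  add_mem' {p p'} hp hp' q hq := by
    have h₁ := hp q hq
    have h₂ := hp' q hq
    simp only [bform] at h₁ h₂ ⊢
    simp only [Prod.fst_add, Prod.snd_add, Matrix.mulVec_add, add_dotProduct]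
    linear_combination h₁ + h₂
  smul_mem' c p hp q hq := by
    have h₁ := hp q hq
    simp only [bform] at h₁ ⊢
    simp only [Prod.smul_fst, Prod.smul_snd, Matrix.mulVec_smul, smul_dotProduct, smul_eq_mul]
    linear_combination c * h₁

end Traces

/-! ### Extensions of the minimal operator -/

section Extensions

variable {k : ℕ} {L : ℝ} {α β : Edge k → ℝ} {A : L2G k L →ₗ.[ℂ] L2G k L}

theorem graph_neg_adjoint_le (hA : airy L α β ≤ A) :
    (-A.adjoint).graph ≤ (-(airy L α β).adjoint).graph := by
  have hd : Dense (A.domain : Set (L2G k L)) := dense_airy_domain.mono hA.1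
  intro p hp
  rw [mem_graph_neg_adjoint_iff hd] at hp
  rw [mem_graph_neg_adjoint_iff dense_airy_domain]
  exact fun a b hab => hp a b (LinearPMap.le_graph_of_le hA hab)

/-- Membership in the graph of `-A*` is `w`-orthogonality to the boundary values of `A`, for
`A` between the minimal and the maximal operator. -/
theorem mem_graph_neg_adjoint_iff_bform (hL : 0 < L) (hα : ∀ e, α e ≠ 0) (hA : airy L α β ≤ A)
    (hAM : A.graph ≤ (-(airy L α β).adjoint).graph) {p : L2G k L × L2G k L}
    (hp : p ∈ (-(airy L α β).adjoint).graph) :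
    p ∈ (-A.adjoint).graph ↔ ∀ q ∈ A.graph,
      bform α β (tracePlus p.1, traceMinus p.1) (tracePlus q.1, traceMinus q.1) = 0 := by
  have hd : Dense (A.domain : Set (L2G k L)) := dense_airy_domain.mono hA.1
  rw [mem_graph_neg_adjoint_iff hd]
  constructor
  · rintro h ⟨a, b⟩ hq
    have := h a b hq
    rwa [inner_add_inner_eq hL hα hp (hAM hq), neg_eq_zero] at this
  · intro h a b hq
    have := inner_add_inner_eq hL hα hp (hAM hq)
    dsimp only at this
    rw [this, h _ hq, neg_zero]

theorem graph_eq_image_iff (X : Submodule ℂ (BVec k × BVec k)) :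
    (A.graph : Set (L2G k L × L2G k L)) =
        Subtype.val '' (traceMap L α β ⁻¹' (X : Set (BVec k × BVec k))) ↔
      ∀ p, p ∈ A.graph ↔
        p ∈ (-(airy L α β).adjoint).graph ∧ (tracePlus p.1, traceMinus p.1) ∈ X := by
  rw [Set.ext_iff]
  refine forall_congr' fun p => iff_congr Iff.rfl ?_
  constructor
  · rintro ⟨p', hp', rfl⟩
    exact ⟨p'.2, hp'⟩
  · rintro ⟨h₁, h₂⟩
    exact ⟨⟨p, h₁⟩, h₂, rfl⟩

theorem exists_isSelfOrthogonal_of_isSkewSelfAdjoint (hL : 0 < L) (hα : ∀ e, α e ≠ 0)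
    (hA : airy L α β ≤ A) (h : (-A.adjoint).graph = A.graph) :
    ∃ X : Submodule ℂ (BVec k × BVec k), IsSelfOrthogonal L α β X ∧ ∀ p, p ∈ A.graph ↔
      p ∈ (-(airy L α β).adjoint).graph ∧ (tracePlus p.1, traceMinus p.1) ∈ X := by
  have hAM : A.graph ≤ (-(airy L α β).adjoint).graph := h ▸ graph_neg_adjoint_le hA
  set S : Set (BVec k × BVec k) :=
    (fun p : L2G k L × L2G k L => (tracePlus p.1, traceMinus p.1)) '' A.graph
  have key {p : L2G k L × L2G k L} (hp : p ∈ (-(airy L α β).adjoint).graph) :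
      p ∈ A.graph ↔ (tracePlus p.1, traceMinus p.1) ∈ orthogonalTo α β S := by
    rw [← h, mem_graph_neg_adjoint_iff_bform hL hα hA hAM hp]
    constructor
    · rintro hq _ ⟨q, hqA, rfl⟩
      exact hq q hqA
    · exact fun hq q hqA => hq _ ⟨q, hqA, rfl⟩
  have hXS : (orthogonalTo α β S : Set (BVec k × BVec k)) = S := by
    ext x
    constructor
    · intro hx
      obtain ⟨p, hp, rfl⟩ := exists_mem_graph_trace_eq hL hα x
      exact ⟨p, (key hp).2 hx, rfl⟩
    · rintro ⟨p, hp, rfl⟩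
      exact (key (hAM hp)).1 hp
  refine ⟨orthogonalTo α β S, (isSelfOrthogonal_iff hL _).2 fun p => ?_, fun p => ?_⟩
  · refine forall_congr' fun q => ?_
    rw [← SetLike.mem_coe, hXS]
  · exact ⟨fun hp => ⟨hAM hp, (key (hAM hp)).1 hp⟩, fun hp => (key hp.1).2 hp.2⟩

theorem graph_neg_adjoint_eq_of_isSelfOrthogonal (hL : 0 < L) (hα : ∀ e, α e ≠ 0)
    (hA : airy L α β ≤ A) {X : Submodule ℂ (BVec k × BVec k)} (hX : IsSelfOrthogonal L α β X)
    (hG : ∀ p, p ∈ A.graph ↔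
      p ∈ (-(airy L α β).adjoint).graph ∧ (tracePlus p.1, traceMinus p.1) ∈ X) :
    (-A.adjoint).graph = A.graph := by
  have hAM : A.graph ≤ (-(airy L α β).adjoint).graph := fun p hp => ((hG p).1 hp).1
  rw [isSelfOrthogonal_iff hL] at hX
  have key {p : L2G k L × L2G k L} (hp : p ∈ (-(airy L α β).adjoint).graph) :
      p ∈ (-A.adjoint).graph ↔ p ∈ A.graph := by
    rw [mem_graph_neg_adjoint_iff_bform hL hα hA hAM hp, hG, and_iff_right hp, hX]
    constructor
    · intro h x hx
      obtain ⟨q, hq, rfl⟩ := exists_mem_graph_trace_eq hL hα x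
      exact h q ((hG q).2 ⟨hq, hx⟩)
    · exact fun h q hq => h _ ((hG q).1 hq).2
  ext p
  exact ⟨fun hp => (key (graph_neg_adjoint_le hA hp)).1 hp, fun hp => (key (hAM hp)).2 hp⟩

end Extensions

end LoopingEdge

open LoopingEdge
theorem proposition4p1 (k : ℕ) (hk : 0 < k) (L : ℝ) (hL : 0 < L) (α β : Edge k → ℝ)
    (hα₀ : α none ≠ 0)
    (hα_pos : ∀ i : Fin k, 0 < α (some (Sum.inl i)))
    (hα_neg : ∀ i : Fin k, α (some (Sum.inr i)) < 0) :
    ((airy L α β).adjoint.domain : Set (L2G k L)) = sobolevSpaceG 3 k L ∧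
    ∀ A : L2G k L →ₗ.[ℂ] L2G k L, airy L α β ≤ A →
      (IsSkewSelfAdjoint A ↔
        ∃ X : Submodule ℂ (BVec k × BVec k), IsSelfOrthogonal L α β X ∧
          (A.graph : Set (L2G k L × L2G k L)) =
            Subtype.val '' (traceMap L α β ⁻¹' (X : Set (BVec k × BVec k)))) := by
  have hα : ∀ e, α e ≠ 0
    | none => hα₀
    | some (Sum.inl i) => (hα_pos i).ne'
    | some (Sum.inr i) => (hα_neg i).ne
  refine ⟨adjoint_domain_eq hL hα, fun A hA => ?_⟩
  simp only [graph_eq_image_iff,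
    isSkewSelfAdjoint_iff_graph (dense_airy_domain.mono hA.1 : Dense (A.domain : Set (L2G k L)))]
  exact ⟨exists_isSelfOrthogonal_of_isSkewSelfAdjoint hL hα hA,
    fun ⟨_, hX, hG⟩ => graph_neg_adjoint_eq_of_isSelfOrthogonal hL hα hA hX hG⟩
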